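/- Fix a finite vocabulary consisting only of relation symbols (each of some finite arity), at least one of which has arity at least 2. A structure interprets each $k$-ary symbol $R$ as a subset of $M^k$, where $M$ is its universe, and its automorphisms are the permutations of $M$ that preserve and reflect every relation. For $n\ge 1$ let $\mathbf{S}_n$ be the finite set of all structures with universe $[n]=\{1,\dots,n\}$ (labelled structures). For groups $G,H$, write $G\cong H$ if they are isomorphic, and $G\le H$ if $G$ is isomorphic to a subgroup of $H$. For every finite group $G$, the set $\{\mathcal{M}\in\mathbf{S}_n : G\le \mathrm{Aut}(\mathcal{M})\}$ is nonempty for all sufficiently large $n$, and there is a rational number $a$ with $0\le a\le 1$ such that \[ \lim_{n\to\infty}\frac{\big|\{\mathcal{M}\in\mathbf{S}_n : G\cong \mathrm{Aut}(\mathcal{M})\}\big|}{\big|\{\mathcal{M}\in\mathbf{S}_n : G\le \mathrm{Aut}(\mathcal{M})\}\big|}=a . \] -/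

import Mathlib

open FirstOrder Filter Topology

universe u v w

namespace FiniteStructures

/-- The automorphism group of the `L`-structure `S` on `M`, as a group of permutations of `M`:
the permutations underlying the `L`-isomorphisms from `S` to itself. -/
def autGroup {L : FirstOrder.Language.{u, v}} {M : Type w} (S : L.Structure M) :
    Subgroup (Equiv.Perm M) where
  carrier := {σ | ∃ e : M ≃[L] M, e.toEquiv = σ}
  mul_mem' := by
    rintro _ _ ⟨e, rfl⟩ ⟨f, rfl⟩
    exact ⟨e.comp f, rfl⟩
  one_mem' := ⟨FirstOrder.Language.Equiv.refl L M, rfl⟩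
  inv_mem' := by
    rintro _ ⟨e, rfl⟩
    exact ⟨e.symm, rfl⟩

/-- In a relational language, an automorphism is a permutation that preserves and reflects
every relation. -/
theorem mem_autGroup_iff {L : FirstOrder.Language.{u, v}} [L.IsRelational] {M : Type w}
    (S : L.Structure M) (σ : Equiv.Perm M) :
    σ ∈ autGroup S ↔
      ∀ (k : ℕ) (R : L.Relations k) (a : Fin k → M), S.RelMap R (σ ∘ a) ↔ S.RelMap R a := by
  constructor
  · rintro ⟨e, rfl⟩ k R a
    exact e.map_rel R a
  · intro h
    exact ⟨{ σ with
      map_fun' := fun {n} f => isEmptyElim f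
      map_rel' := fun {n} R a => h n R a }, rfl⟩

/-- The group `G` is isomorphic to a subgroup of the group `H`. -/
def IsoToSubgroup (G : Type u) (H : Type v) [Group G] [Group H] : Prop :=
  ∃ K : Subgroup H, Nonempty (G ≃* K)

/-- The set of structures with an `n`-element universe `Fin n` in whose automorphism group
`G` embeds. -/
def structuresWithSubgroup (L : FirstOrder.Language.{u, v}) (G : Type w) [Group G] (n : ℕ) :
    Set (L.Structure (Fin n)) :=
  {S | IsoToSubgroup G (autGroup S)}

/-- The set of structures with an `n`-element universe `Fin n` whose automorphism group is
isomorphic to `G`. -/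
def structuresWithAutGroup (L : FirstOrder.Language.{u, v}) (G : Type w) [Group G] (n : ℕ) :
    Set (L.Structure (Fin n)) :=
  {S | Nonempty (G ≃* autGroup S)}

/-- A finite relational language has only finitely many structures on a given finite set, so the
cardinalities (`Set.ncard`) of sets of such structures are the genuine ones. -/
theorem finite_structure (L : FirstOrder.Language.{u, v}) [L.IsRelational] [Finite (Σ k, L.Relations k)]
    (n : ℕ) : Finite (L.Structure (Fin n)) := by
  refine Finite.of_injective
    (β := (R : Σ k, L.Relations k) → (Fin R.1 → Fin n) → Prop)
    (fun S R => S.RelMap R.2) ?_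
  intro S T h
  ext k f a
  · exact isEmptyElim f
  · have := congrFun (congrFun h ⟨k, f⟩) a
    exact iff_of_eq this

end FiniteStructures

/-!
The automorphism group of a structure on `n` points is a permutation group, and a permutation group
moving exactly `t` points is the extension, along an injection `Fin t ↪ Fin n`, of a group without
fixed points on `Fin t`. The structures are counted according to this group, and both numerator and
denominator turn out to be, up to a negligible error, rational combinations of functions
`n ^ a * 2 ^ ν n` in which `ν` is a polynomial in `n`. Quotients in `[0, 1]` of such functions
converge to rational numbers (`exists_rat_limit`), because two terms `n ^ a * 2 ^ ν n` of the same
order differ by the factor of an integral power of `2`.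

*Few moved points.* If a permutation group moves more than `2 s` points, then some element moves
more than `s` points, since every moved point is moved by at least half of the elements
(`ncard_movedPoints_le`). A permutation moving `s` points has few orbits on `k`-tuples, so few
structures are invariant under it. As some symbol has arity at least two, summing over all
permutations that move many points leaves a negligible number compared with the structures on which
`G` acts through its regular representation on `|G|` of the points
(`card_many_movedPoints_mem_negligible`, `baseCount_le_ncard`). So only `t ≤ T` for a constant `T`
matter.

*Exact counts.* For `K` without fixed points on `Fin t`, let `X K` count the pairs of an injection
`ι : Fin t ↪ Fin n` and a structure whose automorphism group is the extension of `K` along `ι`. The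
number of pairs in which the automorphism group contains the extension of `K` is the number of
injections times `2 ^ ν`, where `ν` is the number of orbits on tuples, a polynomial in `n` by
Burnside's lemma (`weightSum_embWeight_mem`). It is also a combination of the functions `X K'`, with
the number of embeddings of `K` into `K'` as coefficients, and embeddings exist only into larger
groups and into copies of `K`. This triangular system is solved by downward induction on the
order of the group (`exactCount_mem`). Finally, the structures whose automorphism group has any
given isomorphism-invariant property are counted by a combination of the functions `X K`
(`ncard_mem`).
-/

namespace FiniteStructures

/-! ### Exponential monomials and limits of quotients -/

open Polynomial in
/-- `2 ^ R` outgrows every power of `n`, because a nonconstant polynomial `R` is at least linear. -/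
theorem tendsto_pow_mul_two_rpow_neg_eval (R : ℝ[X]) (hdeg : 0 < R.degree)
    (hlc : 0 < R.leadingCoeff) (a : ℕ) :
    Tendsto (fun n : ℕ => (n : ℝ) ^ a * (2 : ℝ) ^ (-(R.eval (n : ℝ)))) atTop (𝓝 0) := by
  have hlog : 0 < Real.log 2 := Real.log_pos (by norm_num)
  have hR : Tendsto (fun x : ℝ => R.eval x) atTop atTop :=
    R.tendsto_atTop_of_leadingCoeff_nonneg hdeg hlc.le
  have hO : (fun x : ℝ => (X : ℝ[X]).eval x) =O[atTop] fun x => R.eval x := by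
    apply Polynomial.isBigO_atTop_of_degree_le
    rw [degree_X]
    exact Nat.WithBot.one_le_iff_zero_lt.mpr hdeg
  obtain ⟨c, hc⟩ := hO.bound
  have hy : Tendsto (fun x : ℝ => Real.log 2 * R.eval x) atTop atTop := hR.const_mul_atTop hlog
  have key : Tendsto (fun x : ℝ => (c / Real.log 2) ^ a *
      ((Real.log 2 * R.eval x) ^ a * Real.exp (-(Real.log 2 * R.eval x)))) atTop (𝓝 0) := by
    simpa using ((Real.tendsto_pow_mul_exp_neg_atTop_nhds_zero a).comp hy).const_mul
      ((c / Real.log 2) ^ a)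
  have main : Tendsto (fun x : ℝ => x ^ a * (2 : ℝ) ^ (-(R.eval x))) atTop (𝓝 0) := by
    refine squeeze_zero' ?_ ?_ key
    · filter_upwards [eventually_ge_atTop 0] with x hx
      positivity
    · filter_upwards [hc, eventually_ge_atTop 0, hR.eventually_ge_atTop 0] with x h1 hx h2
      rw [Real.norm_eq_abs, Real.norm_eq_abs, eval_X, abs_of_nonneg hx, abs_of_nonneg h2] at h1
      rw [Real.rpow_def_of_pos (by norm_num : (0 : ℝ) < 2), ← mul_assoc, ← mul_pow]
      have : c / Real.log 2 * (Real.log 2 * R.eval x) = c * R.eval x := by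
        field_simp
      rw [this, mul_neg]
      gcongr
  exact main.comp tendsto_natCast_atTop_atTop

/-- A function of the form `n ^ a * 2 ^ ν n` where `ν` eventually agrees with a polynomial. -/
def IsExpMonomial (u : ℕ → ℝ) : Prop :=
  ∃ (a : ℕ) (ν : ℕ → ℕ) (P : Polynomial ℝ),
    (∀ᶠ n : ℕ in atTop, (ν n : ℝ) = P.eval (n : ℝ)) ∧ u = fun n : ℕ => (n : ℝ) ^ a * 2 ^ ν n

theorem IsExpMonomial.eventually_pos {u : ℕ → ℝ} (hu : IsExpMonomial u) :
    ∀ᶠ n in atTop, 0 < u n := by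
  obtain ⟨a, ν, P, -, rfl⟩ := hu
  filter_upwards [eventually_gt_atTop 0] with n hn
  positivity

open Polynomial in
theorem tendsto_expMonomial_div {a b : ℕ} {ν μ : ℕ → ℕ} {P Q : ℝ[X]}
    (hP : ∀ᶠ n : ℕ in atTop, (ν n : ℝ) = P.eval (n : ℝ))
    (hQ : ∀ᶠ n : ℕ in atTop, (μ n : ℝ) = Q.eval (n : ℝ))
    (hdeg : 0 < (Q - P).degree) (hlc : 0 < (Q - P).leadingCoeff) :
    Tendsto (fun n : ℕ => ((n : ℝ) ^ a * 2 ^ ν n) / ((n : ℝ) ^ b * 2 ^ μ n)) atTop (𝓝 0) := by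
  refine squeeze_zero' (Eventually.of_forall fun n => by positivity) ?_
    (tendsto_pow_mul_two_rpow_neg_eval (Q - P) hdeg hlc a)
  filter_upwards [hP, hQ, eventually_gt_atTop 0] with n h1 h2 hn
  have e : (2 : ℝ) ^ (-((Q - P).eval (n : ℝ))) = 2 ^ ν n / 2 ^ μ n := by
    rw [eval_sub, ← h1, ← h2, neg_sub, Real.rpow_sub (by norm_num), Real.rpow_natCast,
      Real.rpow_natCast]
  rw [e, mul_div_mul_comm, div_eq_mul_inv ((n : ℝ) ^ a)]
  have h1 : (1 : ℝ) ≤ (n : ℝ) ^ b := one_le_pow₀ (by exact_mod_cast hn)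
  gcongr
  exact mul_le_of_le_one_right (by positivity) (inv_le_one_of_one_le₀ h1)

theorem tendsto_natCast_pow_div {a b : ℕ} (h : a < b) (c : ℝ) :
    Tendsto (fun n : ℕ => ((n : ℝ) ^ a * c) / (n : ℝ) ^ b) atTop (𝓝 0) := by
  have h1 : Tendsto (fun x : ℝ => x ^ a / x ^ b) atTop (𝓝 0) :=
    tendsto_pow_div_pow_atTop_zero h
  have := (h1.comp tendsto_natCast_atTop_atTop).mul_const c
  simp only [zero_mul] at this
  refine this.congr fun n => ?_
  simp only [Function.comp]
  ring

/-- Exponential monomials are comparable, and those of the same order are rational multiples of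
each other: exponents whose polynomials differ by a constant differ by an integer, as they take
integer values. -/
theorem IsExpMonomial.trichotomy {u v : ℕ → ℝ} (hu : IsExpMonomial u) (hv : IsExpMonomial v) :
    (∃ c : ℚ, u =ᶠ[atTop] fun n => (c : ℝ) * v n) ∨
      Tendsto (fun n => u n / v n) atTop (𝓝 0) ∨ Tendsto (fun n => v n / u n) atTop (𝓝 0) := by
  obtain ⟨a, ν, P, hP, rfl⟩ := hu
  obtain ⟨b, μ, Q, hQ, rfl⟩ := hv
  by_cases hdeg : 0 < (Q - P).degree
  · have hne : Q - P ≠ 0 := by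
      rintro h
      simp [h] at hdeg
    rcases lt_trichotomy (Q - P).leadingCoeff 0 with h | h | h
    · right; right
      have e : P - Q = -(Q - P) := by ring
      refine tendsto_expMonomial_div hQ hP ?_ ?_
      · rwa [e, Polynomial.degree_neg]
      · rw [e, Polynomial.leadingCoeff_neg]; linarith
    · exact absurd (Polynomial.leadingCoeff_eq_zero.mp h) hne
    · right; left
      exact tendsto_expMonomial_div hP hQ hdeg h
  · obtain ⟨c, hc⟩ : ∃ c, Q - P = Polynomial.C c :=
      ⟨_, Polynomial.eq_C_of_degree_le_zero (not_lt.mp hdeg)⟩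
    have hconst : ∀ᶠ n : ℕ in atTop, (μ n : ℝ) - ν n = c := by
      filter_upwards [hP, hQ] with n h1 h2
      rw [h1, h2, ← Polynomial.eval_sub, hc, Polynomial.eval_C]
    obtain ⟨m, hm⟩ := hconst.exists
    have hpow : ∀ᶠ n : ℕ in atTop, (2 : ℝ) ^ ν n = 2 ^ ν m / 2 ^ μ m * 2 ^ μ n := by
      filter_upwards [hconst] with n hn
      have : μ n + ν m = ν n + μ m := by
        have : (μ n : ℝ) + ν m = ν n + μ m := by linarith
        exact_mod_cast this
      rw [div_mul_eq_mul_div, eq_div_iff (by positivity), ← pow_add, ← pow_add, ← this, add_comm]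
    set d : ℝ := 2 ^ ν m / 2 ^ μ m with hd
    have hd0 : 0 < d := by positivity
    rcases lt_trichotomy a b with h | h | h
    · right; left
      refine (tendsto_natCast_pow_div h d).congr' ?_
      filter_upwards [hpow] with n hn
      rw [hn, ← mul_assoc, mul_div_mul_right _ _ (by positivity)]
    · left
      refine ⟨2 ^ ν m / 2 ^ μ m, ?_⟩
      filter_upwards [hpow] with n hn
      push_cast
      rw [hn, h, ← hd]
      ring
    · right; right
      refine (tendsto_natCast_pow_div h d⁻¹).congr' ?_
      filter_upwards [hpow] with n hn
      rw [hn]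
      field_simp

/-- `v` is negligible against `u`, or eventually a rational multiple of `u`. -/
def DominatedBy (v u : ℕ → ℝ) : Prop :=
  Tendsto (fun n => v n / u n) atTop (𝓝 0) ∨ ∃ c : ℚ, v =ᶠ[atTop] fun n => (c : ℝ) * u n

theorem exists_dominating (s : Finset (ℕ → ℝ)) (hs : ∀ u ∈ s, IsExpMonomial u)
    (hne : s.Nonempty) : ∃ u ∈ s, ∀ v ∈ s, DominatedBy v u := by
  classical
  induction hne using Finset.Nonempty.cons_induction with
  | singleton a =>
    refine ⟨a, by simp, fun v hv => Or.inr ⟨1, ?_⟩⟩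
    rw [Finset.mem_singleton.mp hv]
    simp
  | cons a s ha hne ih =>
    obtain ⟨u, hu, hdom⟩ := ih fun v hv => hs v (Finset.mem_cons_of_mem hv)
    have hum := hs u (Finset.mem_cons_of_mem hu)
    have ham := hs a (Finset.mem_cons_self _ _)
    by_cases hau : DominatedBy a u
    · refine ⟨u, Finset.mem_cons_of_mem hu, fun v hv => ?_⟩
      rcases Finset.mem_cons.mp hv with rfl | hv
      · exact hau
      · exact hdom v hv
    · have hua : Tendsto (fun n => u n / a n) atTop (𝓝 0) := by
        rcases ham.trichotomy hum with h | h | h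
        · exact absurd (Or.inr h) hau
        · exact absurd (Or.inl h) hau
        · exact h
      refine ⟨a, Finset.mem_cons_self _ _, fun v hv => ?_⟩
      rcases Finset.mem_cons.mp hv with rfl | hv
      · exact Or.inr ⟨1, by simp⟩
      · left
        rcases hdom v hv with h | ⟨c, h⟩
        · have := h.mul hua
          rw [zero_mul] at this
          refine this.congr' ?_
          filter_upwards [hum.eventually_pos] with n hn
          field_simp
        · have := hua.const_mul (c : ℝ)
          rw [mul_zero] at this
          refine this.congr' ?_
          filter_upwards [h] with n hn
          rw [hn, mul_div_assoc]

/-- The rational span of the functions `n ^ a * 2 ^ ν n` with `ν` eventually polynomial. -/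
noncomputable def expSpan : Submodule ℚ (ℕ → ℝ) := Submodule.span ℚ {u | IsExpMonomial u}

theorem finsetSum_leading_term (s : Finset (ℕ → ℝ)) (hs : ∀ u ∈ s, IsExpMonomial u)
    (q : (ℕ → ℝ) → ℚ) :
    (∑ v ∈ s, q v • v) =ᶠ[atTop] 0 ∨ ∃ u, IsExpMonomial u ∧ ∃ c : ℚ, c ≠ 0 ∧
      Tendsto (fun n => (∑ v ∈ s, q v • v) n / u n) atTop (𝓝 (c : ℝ)) := by
  classical
  induction s using Finset.strongInduction with
  | H s ih =>
    rcases s.eq_empty_or_nonempty with rfl | hne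
    · left; simp
    obtain ⟨u, hu, hdom⟩ := exists_dominating s hs hne
    have hum := hs u hu
    let p : (ℕ → ℝ) → Prop := fun v => Tendsto (fun n => v n / u n) atTop (𝓝 0)
    have hsplit : ∑ v ∈ s, q v • v =
        ∑ v ∈ s with ¬ p v, q v • v + ∑ v ∈ s with p v, q v • v := by
      rw [add_comm, Finset.sum_filter_add_sum_filter_not]
    have hup : ¬ p u := by
      intro h
      have h1 : Tendsto (fun n => u n / u n) atTop (𝓝 1) := by
        refine tendsto_const_nhds.congr' ?_
        filter_upwards [hum.eventually_pos] with n hn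
        rw [div_self hn.ne']
      exact zero_ne_one (tendsto_nhds_unique h h1)
    have hss : s.filter p ⊂ s :=
      Finset.filter_ssubset.mpr ⟨u, hu, hup⟩
    have hprop : ∀ v ∈ s.filter (fun v => ¬ p v), ∃ c : ℚ, v =ᶠ[atTop] fun n => (c : ℝ) * u n := by
      intro v hv
      rw [Finset.mem_filter] at hv
      rcases hdom v hv.1 with h | h
      · exact absurd h hv.2
      · exact h
    choose! c hc using hprop
    set Q : ℚ := ∑ v ∈ s with ¬ p v, q v * c v with hQ
    have hlead : (∑ v ∈ s with ¬ p v, q v • v) =ᶠ[atTop] fun n => (Q : ℝ) * u n := by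
      have := (eventually_all_finset _).mpr hc
      filter_upwards [this] with n hn
      rw [Finset.sum_apply, hQ, Rat.cast_sum, Finset.sum_mul]
      refine Finset.sum_congr rfl fun v hv => ?_
      rw [Pi.smul_apply, hn v hv, Rat.smul_def]
      push_cast
      ring
    -- If the terms of maximal order cancel, they cancel exactly and can be dropped from the sum.
    by_cases hQ0 : Q = 0
    · have heq : (∑ v ∈ s, q v • v) =ᶠ[atTop] ∑ v ∈ s with p v, q v • v := by
        filter_upwards [hlead] with n hn
        rw [hsplit, Pi.add_apply, hn, hQ0]
        simp
      rcases ih _ hss (fun v hv => hs v (Finset.mem_filter.mp hv).1) with h | ⟨u', hu', c', hc', h⟩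
      · exact Or.inl (heq.trans h)
      · refine Or.inr ⟨u', hu', c', hc', h.congr' ?_⟩
        filter_upwards [heq] with n hn
        rw [hn]
    · refine Or.inr ⟨u, hum, Q, hQ0, ?_⟩
      have hlow : Tendsto (fun n => (∑ v ∈ s with p v, q v • v) n / u n) atTop (𝓝 0) := by
        have h1 : Tendsto (fun n => ∑ v ∈ s with p v, (q v : ℝ) * (v n / u n)) atTop
            (𝓝 (∑ v ∈ s with p v, (q v : ℝ) * 0)) :=
          tendsto_finsetSum _ fun v hv => (Finset.mem_filter.mp hv).2.const_mul _
        simp only [mul_zero, Finset.sum_const_zero] at h1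
        refine h1.congr fun n => ?_
        rw [Finset.sum_apply, Finset.sum_div]
        refine Finset.sum_congr rfl fun v _ => ?_
        rw [Pi.smul_apply, Rat.smul_def, mul_div_assoc]
      have h2 := hlow.const_add (Q : ℝ)
      rw [add_zero] at h2
      refine h2.congr' ?_
      filter_upwards [hlead, hum.eventually_pos] with n hn hpos
      rw [hsplit, Pi.add_apply, hn, add_div, mul_div_cancel_right₀ _ hpos.ne']

/-- A function in the span is eventually zero or asymptotic to a nonzero rational multiple of an
exponential monomial. -/
theorem leading_term_of_mem_expSpan {f : ℕ → ℝ} (hf : f ∈ expSpan) :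
    f =ᶠ[atTop] 0 ∨ ∃ u, IsExpMonomial u ∧ ∃ c : ℚ, c ≠ 0 ∧
      Tendsto (fun n => f n / u n) atTop (𝓝 (c : ℝ)) := by
  obtain ⟨q, t, hts, -, rfl⟩ := Submodule.mem_span_iff_exists_finset_subset.mp hf
  exact finsetSum_leading_term t (fun u hu => hts hu) q

/-- The functions that stay negligible against `w` after multiplication by any power of `n`. -/
noncomputable def negligible (w : ℕ → ℝ) : Submodule ℚ (ℕ → ℝ) where
  carrier := {f | ∀ a : ℕ, Tendsto (fun n : ℕ => (n : ℝ) ^ a * f n / w n) atTop (𝓝 0)}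
  add_mem' := by
    intro f g hf hg a
    have := (hf a).add (hg a)
    rw [add_zero] at this
    refine this.congr fun n => ?_
    rw [Pi.add_apply]
    ring
  zero_mem' := by
    intro a
    simp
  smul_mem' := by
    intro c f hf a
    have := (hf a).const_mul (c : ℝ)
    rw [mul_zero] at this
    refine this.congr fun n => ?_
    rw [Pi.smul_apply, Rat.smul_def]
    ring

theorem negligible_of_eventually_zero {w f : ℕ → ℝ} (hf : f =ᶠ[atTop] 0) :
    f ∈ negligible w := by
  intro a
  refine tendsto_const_nhds.congr' ?_
  filter_upwards [hf] with n hn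
  simp [hn]

theorem negligible_of_le {w f g : ℕ → ℝ} (hw : ∀ n, 0 < w n) (hg : g ∈ negligible w) (b : ℕ)
    (hfg : ∀ᶠ n : ℕ in atTop, |f n| ≤ (n : ℝ) ^ b * g n) : f ∈ negligible w := by
  intro a
  refine squeeze_zero_norm' ?_ (hg (a + b))
  filter_upwards [hfg] with n hn
  rw [norm_div, norm_mul, Real.norm_eq_abs, Real.norm_eq_abs, Real.norm_eq_abs,
    abs_of_pos (hw n), abs_of_nonneg (by positivity : (0 : ℝ) ≤ (n : ℝ) ^ a), pow_add, mul_assoc]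
  have := hw n
  gcongr

theorem mem_expSpan_sup_negligible_of_eventuallyEq {w f g : ℕ → ℝ}
    (hg : g ∈ expSpan ⊔ negligible w) (h : f =ᶠ[atTop] g) : f ∈ expSpan ⊔ negligible w := by
  have : f = g + (f - g) := by abel
  rw [this]
  refine add_mem hg (Submodule.mem_sup_right (negligible_of_eventually_zero ?_))
  filter_upwards [h] with n hn
  simp [hn]

/-- Leading terms of functions in the span have rational ratios; a quotient bounded
by `1` cannot have a numerator of larger order than its denominator. -/
theorem exists_rat_limit {w f g : ℕ → ℝ} (hw : ∀ n, 0 < w n) (hf : f ∈ expSpan ⊔ negligible w)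
    (hg : g ∈ expSpan ⊔ negligible w) (hwg : ∀ᶠ n in atTop, w n ≤ g n) (h0 : ∀ n, 0 ≤ f n)
    (hfg : ∀ n, f n ≤ g n) :
    ∃ a : ℚ, 0 ≤ a ∧ a ≤ 1 ∧ Tendsto (fun n => f n / g n) atTop (𝓝 (a : ℝ)) := by
  suffices h : ∃ a : ℚ, Tendsto (fun n => f n / g n) atTop (𝓝 (a : ℝ)) by
    obtain ⟨a, ha⟩ := h
    refine ⟨a, ?_, ?_, ha⟩
    · have : (0 : ℝ) ≤ a :=
        ge_of_tendsto' ha fun n => div_nonneg (h0 n) ((h0 n).trans (hfg n))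
      exact_mod_cast this
    · have : (a : ℝ) ≤ 1 :=
        le_of_tendsto' ha fun n => div_le_one_of_le₀ (hfg n) ((h0 n).trans (hfg n))
      exact_mod_cast this
  have hgpos : ∀ᶠ n in atTop, 0 < g n := by
    filter_upwards [hwg] with n hn
    exact (hw n).trans_le hn
  have hneg : ∀ e ∈ negligible w, Tendsto (fun n => e n / g n) atTop (𝓝 0) := by
    intro e he
    have h1 := (he 0).norm
    rw [norm_zero] at h1
    refine squeeze_zero_norm' ?_ h1
    filter_upwards [hwg] with n hn
    have := hw n
    rw [pow_zero, one_mul, norm_div, norm_div, Real.norm_eq_abs (w n), abs_of_pos this]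
    gcongr
    exact hn.trans (le_abs_self _)
  obtain ⟨f₁, hf₁, e₁, he₁, rfl⟩ := Submodule.mem_sup.mp hf
  obtain ⟨g₁, hg₁, e₂, he₂, rfl⟩ := Submodule.mem_sup.mp hg
  set g := g₁ + e₂ with hgdef
  have hg1 : Tendsto (fun n => g₁ n / g n) atTop (𝓝 1) := by
    have := (hneg e₂ he₂).const_sub 1
    rw [sub_zero] at this
    refine this.congr' ?_
    filter_upwards [hgpos] with n hn
    rw [one_sub_div hn.ne', hgdef, Pi.add_apply, add_sub_cancel_right]
  obtain ⟨u, hu, c, hc, hgu⟩ := (leading_term_of_mem_expSpan hg₁).resolve_left fun h => by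
    have : Tendsto (fun n => g₁ n / g n) atTop (𝓝 0) := by
      refine tendsto_const_nhds.congr' ?_
      filter_upwards [h] with n hn
      simp [hn]
    exact zero_ne_one (tendsto_nhds_unique this hg1)
  have hc' : (c : ℝ) ≠ 0 := by exact_mod_cast hc
  have hug : Tendsto (fun n => u n / g n) atTop (𝓝 (c : ℝ)⁻¹) := by
    have h1 := hg1.mul (hgu.inv₀ hc')
    rw [one_mul] at h1
    refine h1.congr' ?_
    filter_upwards [hgu.eventually_ne hc', hu.eventually_pos] with n hn hn'
    have : g₁ n ≠ 0 := by
      rintro h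
      simp [h] at hn
    field_simp
  -- The negligible part of the numerator does not affect the limit.
  suffices h : ∃ a : ℚ, Tendsto (fun n => f₁ n / g n) atTop (𝓝 (a : ℝ)) by
    obtain ⟨a, ha⟩ := h
    refine ⟨a, ?_⟩
    have := ha.add (hneg e₁ he₁)
    rw [add_zero] at this
    refine this.congr fun n => ?_
    rw [Pi.add_apply, add_div]
  rcases leading_term_of_mem_expSpan hf₁ with h | ⟨v, hv, d, hd, hfv⟩
  · refine ⟨0, tendsto_const_nhds.congr' ?_⟩
    filter_upwards [h] with n hn
    simp [hn]
  rcases hv.trichotomy hu with ⟨q, hq⟩ | h | h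
  · refine ⟨d * q * c⁻¹, ?_⟩
    have := (hfv.mul_const (q : ℝ)).mul hug
    push_cast
    refine this.congr' ?_
    filter_upwards [hq, hu.eventually_pos, hv.eventually_pos] with n h1 h2 h3
    have hqn : (q : ℝ) ≠ 0 := by
      rintro h
      rw [h1, h, zero_mul] at h3
      exact h3.false
    rw [h1]
    field_simp
  · refine ⟨0, ?_⟩
    have := (hfv.mul h).mul hug
    rw [mul_zero, zero_mul] at this
    rw [Rat.cast_zero]
    refine this.congr' ?_
    filter_upwards [hu.eventually_pos, hv.eventually_pos] with n h2 h3
    field_simp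
  · -- Here the quotient would be unbounded, against `f ≤ g`.
    exfalso
    have h1 : Tendsto (fun n => (f₁ n + e₁ n) / g n * ((u n / g n)⁻¹ * (u n / v n)))
        atTop (𝓝 0) := by
      have h2 := (hug.inv₀ (inv_ne_zero hc')).mul h
      rw [mul_zero] at h2
      have h2' := h2.norm
      rw [norm_zero] at h2'
      refine squeeze_zero_norm' ?_ h2'
      filter_upwards [hgpos] with n hn
      have h3 : 0 ≤ (f₁ n + e₁ n) / g n := div_nonneg (h0 n) hn.le
      rw [norm_mul, Real.norm_eq_abs ((f₁ n + e₁ n) / g n), abs_of_nonneg h3]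
      exact mul_le_of_le_one_left (norm_nonneg _) (div_le_one_of_le₀ (hfg n) hn.le)
    have h3 : Tendsto (fun n => e₁ n / g n * ((u n / g n)⁻¹ * (u n / v n))) atTop (𝓝 0) := by
      have := (hneg e₁ he₁).mul ((hug.inv₀ (inv_ne_zero hc')).mul h)
      rwa [zero_mul] at this
    have h4 := h1.sub h3
    rw [sub_zero] at h4
    have h5 : Tendsto (fun n => f₁ n / v n) atTop (𝓝 0) := by
      refine h4.congr' ?_
      filter_upwards [hgpos, hu.eventually_pos, hv.eventually_pos] with n h1 h2 h3
      rw [← sub_mul, ← sub_div, add_sub_cancel_right]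
      field_simp
    have h6 := tendsto_nhds_unique h5 hfv
    exact hd (by exact_mod_cast h6.symm)

/-! ### Permutation groups and their moved points -/

open Equiv

/-- The points moved by some element of a permutation group. -/
def movedPoints {α : Type*} (H : Subgroup (Perm α)) : Set α := {x | ∃ g ∈ H, g x ≠ x}

/-- The permutation group on the range of `ι` corresponding to `K`, acting trivially elsewhere. -/
noncomputable def extendGroup {α β : Type*} (ι : α ↪ β) (K : Subgroup (Perm α)) :
    Subgroup (Perm β) :=
  K.map (Perm.viaEmbeddingHom ι)

theorem movedPoints_extendGroup {α β : Type*} (ι : α ↪ β) (K : Subgroup (Perm α)) :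
    movedPoints (extendGroup ι K) = ι '' movedPoints K := by
  ext x
  constructor
  · rintro ⟨_, ⟨g, hg, rfl⟩, hx⟩
    rw [Perm.viaEmbeddingHom_apply] at hx
    by_cases h : x ∈ Set.range ι
    · obtain ⟨y, rfl⟩ := h
      rw [Perm.viaEmbedding_apply] at hx
      exact ⟨y, ⟨g, hg, fun h => hx (by rw [h])⟩, rfl⟩
    · exact absurd (Perm.viaEmbedding_apply_of_notMem g ι x h) hx
  · rintro ⟨y, ⟨g, hg, hy⟩, rfl⟩
    refine ⟨_, ⟨g, hg, rfl⟩, ?_⟩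
    rw [Perm.viaEmbeddingHom_apply, Perm.viaEmbedding_apply]
    exact fun h => hy (ι.injective h)

theorem mem_range_viaEmbeddingHom {α β : Type*} (ι : α ↪ β) (g : Perm β)
    (hg : ∀ x, g x ≠ x → x ∈ Set.range ι) : g ∈ (Perm.viaEmbeddingHom ι).range := by
  classical
  have hg' : ∀ x, g x ∈ Set.range ι ↔ x ∈ Set.range ι := by
    intro x
    by_cases h : g x = x
    · rw [h]
    · exact iff_of_true (hg _ fun h' => h (g.injective h')) (hg x h)
  refine ⟨(Equiv.ofInjective ι ι.injective).symm.permCongr (g.subtypePerm hg'), ?_⟩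
  ext x
  rw [Perm.viaEmbeddingHom_apply]
  by_cases h : x ∈ Set.range ι
  · obtain ⟨y, rfl⟩ := h
    rw [Perm.viaEmbedding_apply]
    have := Equiv.apply_ofInjective_symm ι.injective ⟨g (ι y), (hg' _).mpr ⟨y, rfl⟩⟩
    simpa [Equiv.permCongr_apply] using this
  · rw [Perm.viaEmbedding_apply_of_notMem _ _ _ h]
    by_contra h'
    exact h (hg x fun h'' => h' h''.symm)

theorem extendGroup_comap {α β : Type*} (ι : α ↪ β) (H : Subgroup (Perm β))
    (hH : movedPoints H ⊆ Set.range ι) : extendGroup ι (H.comap (Perm.viaEmbeddingHom ι)) = H := by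
  rw [extendGroup, Subgroup.map_comap_eq, inf_eq_right]
  exact fun g hg => mem_range_viaEmbeddingHom ι g fun x hx => hH ⟨g, hg, hx⟩

theorem movedPoints_comap {α β : Type*} (ι : α ↪ β) (H : Subgroup (Perm β))
    (hH : Set.range ι = movedPoints H) :
    movedPoints (H.comap (Perm.viaEmbeddingHom ι)) = Set.univ := by
  have h := movedPoints_extendGroup ι (H.comap (Perm.viaEmbeddingHom ι))
  rw [extendGroup_comap ι H hH.ge, ← hH, ← Set.image_univ] at h
  exact (Set.image_injective.mpr ι.injective h).symm

theorem extendGroup_le_iff {α β : Type*} (ι : α ↪ β) {K K' : Subgroup (Perm α)} :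
    extendGroup ι K ≤ extendGroup ι K' ↔ K ≤ K' :=
  Subgroup.map_le_map_iff_of_injective (Perm.viaEmbeddingHom_injective ι)

theorem extendGroup_trans {α β γ : Type*} (j : α ↪ β) (ι : β ↪ γ) (K : Subgroup (Perm α)) :
    extendGroup (j.trans ι) K = extendGroup ι (extendGroup j K) := by
  rw [extendGroup, extendGroup, extendGroup, Subgroup.map_map]
  congr 1
  ext g x
  simp only [MonoidHom.comp_apply, Perm.viaEmbeddingHom_apply]
  by_cases h : x ∈ Set.range ι
  · obtain ⟨y, rfl⟩ := h
    rw [Perm.viaEmbedding_apply]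
    by_cases h : y ∈ Set.range j
    · obtain ⟨z, rfl⟩ := h
      rw [Perm.viaEmbedding_apply]
      exact Perm.viaEmbedding_apply g (j.trans ι) z
    · rw [Perm.viaEmbedding_apply_of_notMem _ _ _ h, Perm.viaEmbedding_apply_of_notMem]
      rintro ⟨z, hz⟩
      exact h ⟨z, ι.injective hz⟩
  · rw [Perm.viaEmbedding_apply_of_notMem _ _ _ h, Perm.viaEmbedding_apply_of_notMem]
    rintro ⟨z, hz⟩
    exact h ⟨j z, hz⟩

noncomputable def extendGroupEquiv {α β : Type*} (ι : α ↪ β) (K : Subgroup (Perm α)) :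
    K ≃* extendGroup ι K :=
  K.equivMapOfInjective _ (Perm.viaEmbeddingHom_injective ι)

/-- A group moving exactly `t` points is the extension of a group without fixed points on
`Fin t`, once for each enumeration of the moved points. -/
theorem card_extendGroup_eq {β : Type*} [Finite β] (H : Subgroup (Perm β)) (t : ℕ) :
    Nat.card {p : (Fin t ↪ β) × Subgroup (Perm (Fin t)) //
      movedPoints p.2 = Set.univ ∧ extendGroup p.1 p.2 = H} =
    if (movedPoints H).ncard = t then t.factorial else 0 := by
  classical
  have hrange : ∀ p : {p : (Fin t ↪ β) × Subgroup (Perm (Fin t)) //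
      movedPoints p.2 = Set.univ ∧ extendGroup p.1 p.2 = H},
      Set.range p.1.1 = movedPoints H := by
    rintro ⟨⟨ι, K⟩, hK, hH⟩
    simp only at hK hH ⊢
    rw [← hH, movedPoints_extendGroup, hK, Set.image_univ]
  let F : {p : (Fin t ↪ β) × Subgroup (Perm (Fin t)) //
      movedPoints p.2 = Set.univ ∧ extendGroup p.1 p.2 = H} ≃ (Fin t ≃ movedPoints H) :=
    { toFun := fun p => (Equiv.ofInjective p.1.1 p.1.1.injective).trans
        (Equiv.setCongr (hrange p))
      invFun := fun e =>
        ⟨(e.toEmbedding.trans (Function.Embedding.subtype _),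
          H.comap (Perm.viaEmbeddingHom (e.toEmbedding.trans (Function.Embedding.subtype _)))), by
          have hr : Set.range (e.toEmbedding.trans (Function.Embedding.subtype _)) =
              movedPoints H := by
            ext x
            constructor
            · rintro ⟨i, rfl⟩
              exact (e i).2
            · intro hx
              exact ⟨e.symm ⟨x, hx⟩, by simp⟩
          have hext := extendGroup_comap (e.toEmbedding.trans (Function.Embedding.subtype _)) H
            hr.ge
          exact ⟨movedPoints_comap _ H hr, hext⟩⟩
      left_inv := by
        rintro ⟨⟨ι, K⟩, hK, hH⟩
        have h1 : ∀ e : Fin t ↪ β, e = ι → (e, H.comap (Perm.viaEmbeddingHom e)) = (ι, K) := by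
          rintro _ rfl
          simp only at hH
          rw [← hH, extendGroup,
            Subgroup.comap_map_eq_self_of_injective (Perm.viaEmbeddingHom_injective _)]
        apply Subtype.ext
        apply h1
        ext i
        simp
      right_inv := by
        intro e
        ext i
        simp }
  rw [Nat.card_congr F]
  split_ifs with h
  · have : Nonempty (Fin t ≃ movedPoints H) := by
      refine ⟨(Finite.equivFinOfCardEq ?_).symm⟩
      rw [← h, Nat.card_coe_set_eq]
    obtain ⟨e⟩ := this
    have : Fintype (movedPoints H) := Fintype.ofFinite _
    rw [Nat.card_eq_fintype_card, Fintype.card_equiv e, Fintype.card_fin]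
  · have : IsEmpty (Fin t ≃ movedPoints H) := by
      refine ⟨fun e => h ?_⟩
      rw [← Nat.card_coe_set_eq, ← Nat.card_congr e, Nat.card_eq_fintype_card, Fintype.card_fin]
    exact Nat.card_of_isEmpty

/-- At least half of the elements of a finite permutation group move a given moved point, so if
every element moves few points, few points are moved altogether. -/
theorem ncard_movedPoints_le {β : Type*} [Fintype β] [DecidableEq β] (H : Subgroup (Perm β))
    (s : ℕ) (hs : ∀ g ∈ H, g.support.card ≤ s) : (movedPoints H).ncard ≤ 2 * s := by
  classical
  have hhalf : ∀ x ∈ (movedPoints H).toFinset,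
      Fintype.card H ≤ 2 * (Finset.univ.filter fun g : H => (g : Perm β) x ≠ x).card := by
    intro x hx
    obtain ⟨h, hh, hx⟩ := Set.mem_toFinset.mp hx
    -- Multiplication by an element moving `x` sends the stabilizer of `x` into its complement.
    have h1 : (Finset.univ.filter fun g : H => (g : Perm β) x = x).card ≤
        (Finset.univ.filter fun g : H => (g : Perm β) x ≠ x).card := by
      refine Finset.card_le_card_of_injOn (fun g => ⟨h, hh⟩ * g) ?_ ?_
      · intro g hg
        simp only [Finset.coe_filter, Finset.mem_univ, true_and, Set.mem_ofPred_eq] at hg ⊢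
        simpa [hg] using hx
      · exact fun a _ b _ hab => mul_left_cancel hab
    have h2 := Finset.card_filter_add_card_filter_not (s := (Finset.univ : Finset H))
      (fun g : H => (g : Perm β) x = x)
    rw [Finset.card_univ] at h2
    simp only [ne_eq] at h1 h2 ⊢
    omega
  have hdouble : ∑ x : β, (Finset.univ.filter fun g : H => (g : Perm β) x ≠ x).card =
      ∑ g : H, (g : Perm β).support.card := by
    simp only [Finset.card_filter, Perm.support]
    exact Finset.sum_comm
  have hpos : 0 < Fintype.card H := Fintype.card_pos
  rw [Set.ncard_eq_toFinset_card']
  refine Nat.le_of_mul_le_mul_right ?_ hpos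
  calc (movedPoints H).toFinset.card * Fintype.card H
      = ∑ x ∈ (movedPoints H).toFinset, Fintype.card H := by
        rw [Finset.sum_const, smul_eq_mul]
    _ ≤ ∑ x ∈ (movedPoints H).toFinset,
          2 * (Finset.univ.filter fun g : H => (g : Perm β) x ≠ x).card :=
        Finset.sum_le_sum hhalf
    _ ≤ ∑ x : β, 2 * (Finset.univ.filter fun g : H => (g : Perm β) x ≠ x).card :=
        Finset.sum_le_univ_sum_of_nonneg fun _ => Nat.zero_le _
    _ = 2 * ∑ g : H, (g : Perm β).support.card := by rw [← Finset.mul_sum, hdouble]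
    _ ≤ 2 * ∑ g : H, s := by gcongr with g; exact hs g g.2
    _ = 2 * s * Fintype.card H := by
        rw [Finset.sum_const, Finset.card_univ, smul_eq_mul]; ring

/-- The number of ways to embed the permutation group `K` into `H`. -/
noncomputable def embCount {α β : Type*} (K : Subgroup (Perm α)) (H : Subgroup (Perm β)) : ℕ :=
  Nat.card {j : α ↪ β // extendGroup j K ≤ H}

/-- A group without fixed points can only be embedded on the moved points of the larger group. -/
theorem embCount_extendGroup {α β γ : Type*} (K : Subgroup (Perm α))
    (hK : movedPoints K = Set.univ) (ι : β ↪ γ) (H : Subgroup (Perm β)) :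
    embCount K (extendGroup ι H) = embCount K H := by
  symm
  refine Nat.card_congr (Equiv.ofBijective
    (fun j => ⟨j.1.trans ι, by
      rw [extendGroup_trans, extendGroup_le_iff]; exact j.2⟩) ⟨?_, ?_⟩)
  · rintro ⟨j, hj⟩ ⟨j', hj'⟩ h
    apply Subtype.ext
    ext x
    have := DFunLike.congr_fun (Subtype.ext_iff.mp h) x
    exact ι.injective this
  · rintro ⟨κ, hκ⟩
    have hr : ∀ x, ∃ y, ι y = κ x := by
      intro x
      have h1 : κ x ∈ movedPoints (extendGroup κ K) := by
        rw [movedPoints_extendGroup, hK]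
        exact ⟨x, trivial, rfl⟩
      obtain ⟨g, hg, hgx⟩ := h1
      have h2 : κ x ∈ movedPoints (extendGroup ι H) := ⟨g, hκ hg, hgx⟩
      rw [movedPoints_extendGroup] at h2
      obtain ⟨y, -, hy⟩ := h2
      exact ⟨y, hy⟩
    choose j hj using hr
    let j' : α ↪ β := ⟨j, fun a b hab => κ.injective (by rw [← hj, ← hj, hab])⟩
    have hκj : κ = j'.trans ι := by
      ext x
      exact (hj x).symm
    refine ⟨⟨j', ?_⟩, Subtype.ext hκj.symm⟩
    rw [hκj, extendGroup_trans, extendGroup_le_iff] at hκ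
    exact hκ

theorem embCount_self_pos {α : Type*} [Finite α] (K : Subgroup (Perm α)) : 0 < embCount K K := by
  have : Nonempty {j : α ↪ α // extendGroup j K ≤ K} := by
    refine ⟨⟨Function.Embedding.refl α, ?_⟩⟩
    rintro _ ⟨g, hg, rfl⟩
    have : Perm.viaEmbeddingHom (Function.Embedding.refl α) g = g := by
      ext x
      exact Perm.viaEmbedding_apply g (Function.Embedding.refl α) x
    rw [this]
    exact hg
  exact Nat.card_pos

/-- A group `H` without fixed points contains an embedded copy of `K` only if it is larger than `K`
or is itself such a copy. -/
theorem card_lt_or_of_embCount_ne_zero {α β : Type*} [Finite α] [Finite β]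
    {K : Subgroup (Perm α)} {H : Subgroup (Perm β)}
    (hH : movedPoints H = Set.univ) (h : embCount K H ≠ 0) :
    Nat.card K < Nat.card H ∨ ∃ e : α ≃ β, extendGroup e.toEmbedding K = H := by
  have : Nonempty {j : α ↪ β // extendGroup j K ≤ H} := by
    by_contra h'
    rw [not_nonempty_iff] at h'
    exact h Nat.card_of_isEmpty
  obtain ⟨j, hj⟩ := this
  have hcard : Nat.card K = Nat.card (extendGroup j K) :=
    Nat.card_congr (extendGroupEquiv j K).toEquiv
  by_cases heq : extendGroup j K = H
  · right
    have hsurj : Function.Surjective j := by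
      intro y
      have : y ∈ movedPoints H := by rw [hH]; trivial
      rw [← heq, movedPoints_extendGroup] at this
      obtain ⟨x, -, hx⟩ := this
      exact ⟨x, hx⟩
    refine ⟨Equiv.ofBijective j ⟨j.injective, hsurj⟩, ?_⟩
    rw [← heq]
    rfl
  · left
    rw [hcard]
    exact lt_of_le_of_ne (Subgroup.card_le_of_le hj) fun h' =>
      heq (Subgroup.eq_of_le_of_card_ge hj h'.ge)

/-! ### Invariant structures and orbits of tuples -/

/-- The number of orbits of a permutation group on `k`-tuples. -/
noncomputable def tupleOrbits {α : Type*} (H : Subgroup (Perm α)) (k : ℕ) : ℕ :=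
  Nat.card (MulAction.orbitRel.Quotient H (Fin k → α))

/-- An invariant structure amounts to a set of orbits of tuples for each relation symbol. -/
theorem card_invariant_structures (L : FirstOrder.Language.{u, v}) [L.IsRelational]
    [Fintype (Σ k, L.Relations k)] {α : Type*} [Finite α] (H : Subgroup (Perm α)) :
    Nat.card {S : L.Structure α // H ≤ autGroup S} =
      2 ^ ∑ R : Σ k, L.Relations k, tupleOrbits H R.1 := by
  let F : {S : L.Structure α // H ≤ autGroup S} ≃
      ((R : Σ k, L.Relations k) → MulAction.orbitRel.Quotient H (Fin R.1 → α) → Prop) :=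
    { toFun := fun S R => Quotient.lift (fun a => S.1.RelMap R.2 a) (by
        rintro a b ⟨g, rfl⟩
        exact propext ((mem_autGroup_iff S.1 _).mp (S.2 g.2) R.1 R.2 b))
      invFun := fun f => ⟨
        { funMap := fun h => isEmptyElim h
          RelMap := fun {k} R a => f ⟨k, R⟩ (Quotient.mk _ a) }, by
          intro g hg
          rw [mem_autGroup_iff]
          intro k R a
          refine iff_of_eq (congrArg (f ⟨k, R⟩) (Quotient.sound ?_))
          exact ⟨⟨g, hg⟩, rfl⟩⟩
      left_inv := by
        rintro ⟨S, hS⟩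
        apply Subtype.ext
        ext k f a
        · exact isEmptyElim f
        · rfl
      right_inv := by
        intro f
        funext R q
        induction q using Quotient.inductionOn
        rfl }
  rw [Nat.card_congr F, Nat.card_pi, ← Finset.prod_pow_eq_pow_sum]
  refine Finset.prod_congr rfl fun R _ => ?_
  rw [Nat.card_fun, tupleOrbits]
  simp

theorem card_fixedBy_tuples {α : Type*} [Fintype α] [DecidableEq α] (H : Subgroup (Perm α))
    (g : H) (k : ℕ) :
    Nat.card (MulAction.fixedBy (Fin k → α) g) =
      (Fintype.card α - (g : Perm α).support.card) ^ k := by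
  have e : MulAction.fixedBy (Fin k → α) g ≃ (Fin k → {x // x ∈ (g : Perm α).supportᶜ}) :=
    { toFun := fun a i => ⟨a.1 i, by
        rw [Finset.mem_compl, Perm.notMem_support]
        exact congrFun a.2 i⟩
      invFun := fun a => ⟨fun i => (a i).1, by
        funext i
        exact Perm.notMem_support.mp (Finset.mem_compl.mp (a i).2)⟩
      left_inv := fun _ => rfl
      right_inv := fun _ => rfl }
  rw [Nat.card_congr e, Nat.card_fun, Nat.card_eq_fintype_card, Nat.card_eq_fintype_card,
    Fintype.card_coe, Finset.card_compl, Fintype.card_fin]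

/-- Burnside's lemma for the action on tuples. -/
theorem tupleOrbits_mul_card {α : Type*} [Fintype α] [DecidableEq α] (H : Subgroup (Perm α))
    [Fintype H] (k : ℕ) :
    tupleOrbits H k * Fintype.card H =
      ∑ g : H, (Fintype.card α - (g : Perm α).support.card) ^ k := by
  classical
  have : Fintype (MulAction.orbitRel.Quotient H (Fin k → α)) := Fintype.ofFinite _
  have h := MulAction.sum_card_fixedBy_eq_card_orbits_mul_card_group H (Fin k → α)
  rw [tupleOrbits, Nat.card_eq_fintype_card]
  refine h.symm.trans (Finset.sum_congr rfl fun g _ => ?_)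
  rw [← card_fixedBy_tuples, Nat.card_eq_fintype_card]

theorem card_support_viaEmbedding {α β : Type*} [Fintype α] [DecidableEq α] [Fintype β]
    [DecidableEq β] (ι : α ↪ β) (g : Perm α) :
    (g.viaEmbedding ι).support.card = g.support.card := by
  rw [← Finset.card_map ι]
  congr 1
  ext x
  rw [Perm.mem_support, Finset.mem_map]
  by_cases h : x ∈ Set.range ι
  · obtain ⟨y, rfl⟩ := h
    simp [Perm.viaEmbedding_apply]
  · rw [Perm.viaEmbedding_apply_of_notMem _ _ _ h]
    simp only [ne_eq, not_true_eq_false, false_iff]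
    rintro ⟨y, -, hy⟩
    exact h ⟨y, hy⟩

theorem tupleOrbits_extendGroup_mul_card {α β : Type*} [Fintype α] [DecidableEq α] [Fintype β]
    [DecidableEq β] (ι : α ↪ β) (K : Subgroup (Perm α)) [Fintype K] (k : ℕ) :
    tupleOrbits (extendGroup ι K) k * Fintype.card K =
      ∑ g : K, (Fintype.card β - (g : Perm α).support.card) ^ k := by
  classical
  have : Fintype (extendGroup ι K) := Fintype.ofFinite _
  rw [Fintype.card_congr (extendGroupEquiv ι K).toEquiv, tupleOrbits_mul_card]
  symm
  refine Fintype.sum_equiv (extendGroupEquiv ι K).toEquiv _ _ fun g => ?_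
  have : ((extendGroupEquiv ι K).toEquiv g : Perm β) =
    (g : Perm α).viaEmbedding ι := rfl
  rw [this, card_support_viaEmbedding]

theorem pow_le_tupleOrbits_extendGroup {α β : Type*} [Fintype α] [Fintype β]
    (ι : α ↪ β) (K : Subgroup (Perm α)) (k : ℕ) :
    (Fintype.card β - Fintype.card α) ^ k ≤ tupleOrbits (extendGroup ι K) k := by
  classical
  have : Fintype K := Fintype.ofFinite _
  refine Nat.le_of_mul_le_mul_right ?_ (Fintype.card_pos (α := K))
  rw [tupleOrbits_extendGroup_mul_card]
  calc (Fintype.card β - Fintype.card α) ^ k * Fintype.card K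
      = ∑ g : K, (Fintype.card β - Fintype.card α) ^ k := by
        rw [Finset.sum_const, Finset.card_univ, smul_eq_mul, mul_comm]
    _ ≤ _ := by
        gcongr with g
        exact Finset.card_le_univ _

open Polynomial in
/-- By Burnside's lemma, the number of orbits is a polynomial in the number of points as fixed
points are added. -/
theorem exists_polynomial_tupleOrbits {t : ℕ} (K : Subgroup (Perm (Fin t))) (k : ℕ) :
    ∃ P : ℝ[X], ∀ n, t ≤ n → ∀ ι : Fin t ↪ Fin n,
      (tupleOrbits (extendGroup ι K) k : ℝ) = P.eval (n : ℝ) := by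
  classical
  have : Fintype K := Fintype.ofFinite _
  refine ⟨C (Fintype.card K : ℝ)⁻¹ *
    ∑ g : K, (X - C ((g : Perm (Fin t)).support.card : ℝ)) ^ k, fun n hn ι => ?_⟩
  have h := tupleOrbits_extendGroup_mul_card ι K k
  rw [Fintype.card_fin] at h
  have h' : (tupleOrbits (extendGroup ι K) k : ℝ) * Fintype.card K =
      ∑ g : K, ((n : ℝ) - ((g : Perm (Fin t)).support.card : ℝ)) ^ k := by
    rw [← Nat.cast_mul, h, Nat.cast_sum]
    refine Finset.sum_congr rfl fun g _ => ?_
    rw [Nat.cast_pow, Nat.cast_sub]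
    exact (Finset.card_le_univ _).trans (by simpa using hn)
  have hpos : (Fintype.card K : ℝ) ≠ 0 := by exact_mod_cast Fintype.card_ne_zero
  rw [eval_mul, eval_finsetSum, eval_C]
  simp only [eval_pow, eval_sub, eval_X, eval_C]
  rw [← h']
  field_simp

/-- Orbits that are not single points fixed by `g` have at least two elements. -/
theorem two_mul_card_orbits_le {G X : Type*} [Group G] [MulAction G X] [Finite X] (g : G) :
    2 * Nat.card (MulAction.orbitRel.Quotient G X) ≤
      Nat.card X + Nat.card (MulAction.fixedBy X g) := by
  classical
  have : Fintype X := Fintype.ofFinite _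
  have : Fintype (MulAction.orbitRel.Quotient G X) := Fintype.ofFinite _
  let π : X → MulAction.orbitRel.Quotient G X := Quotient.mk _
  let A := (Finset.univ.filter fun x : X => g • x = x).image π
  have hA : A.card ≤ Nat.card (MulAction.fixedBy X g) := by
    refine Finset.card_image_le.trans (le_of_eq ?_)
    rw [Nat.card_eq_fintype_card, Fintype.card_subtype]
    rfl
  have hX : Fintype.card X = ∑ q, (Finset.univ.filter fun x => π x = q).card :=
    Finset.card_eq_sum_card_fiberwise fun _ _ => Finset.mem_univ _
  have hone : ∀ q, 2 ≤ (Finset.univ.filter fun x => π x = q).card + if q ∈ A then 1 else 0 := by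
    intro q
    obtain ⟨x, rfl⟩ : ∃ x, π x = q := Quotient.exists_rep q
    split_ifs with h
    · have : 0 < (Finset.univ.filter fun y => π y = π x).card :=
        Finset.card_pos.mpr ⟨x, Finset.mem_filter.mpr ⟨Finset.mem_univ _, rfl⟩⟩
      omega
    · have h1 : 1 < (Finset.univ.filter fun y => π y = π x).card := by
        refine Finset.one_lt_card.mpr ⟨x, Finset.mem_filter.mpr ⟨Finset.mem_univ _, rfl⟩, g • x,
          Finset.mem_filter.mpr ⟨Finset.mem_univ _, Quotient.sound ⟨g, rfl⟩⟩, fun hx => ?_⟩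
        exact h (Finset.mem_image.mpr
          ⟨x, Finset.mem_filter.mpr ⟨Finset.mem_univ _, hx.symm⟩, rfl⟩)
      omega
  have hsum := Finset.sum_le_sum fun q (_ : q ∈ Finset.univ) => hone q
  rw [Finset.sum_add_distrib, ← hX, Finset.sum_const, smul_eq_mul, Finset.card_univ,
    Finset.sum_ite_mem, Finset.univ_inter, Finset.sum_const, smul_eq_mul, mul_one] at hsum
  rw [Nat.card_eq_fintype_card, Nat.card_eq_fintype_card (α := X)]
  omega

theorem two_mul_tupleOrbits_zpowers_le {α : Type*} [Fintype α] [DecidableEq α] (g : Perm α)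
    (k : ℕ) :
    2 * tupleOrbits (Subgroup.zpowers g) k ≤
      Fintype.card α ^ k + (Fintype.card α - g.support.card) ^ k := by
  have h := two_mul_card_orbits_le (X := Fin k → α)
    (⟨g, Subgroup.mem_zpowers g⟩ : Subgroup.zpowers g)
  rw [card_fixedBy_tuples, Nat.card_fun, Nat.card_eq_fintype_card (α := Fin k),
    Nat.card_eq_fintype_card (α := α), Fintype.card_fin] at h
  exact h

theorem pow_sub_mul_le_sub_pow {n t : ℝ} (ht : 0 ≤ t) (htn : t ≤ n) (k : ℕ) :
    n ^ (k + 1) - (k + 1) * t * n ^ k ≤ (n - t) ^ (k + 1) := by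
  induction k with
  | zero => simp
  | succ k ih =>
    have hn : 0 ≤ n := ht.trans htn
    calc n ^ (k + 1 + 1) - ((k + 1 : ℕ) + 1) * t * n ^ (k + 1)
        ≤ n ^ (k + 1 + 1) - ((k + 1 : ℕ) + 1) * t * n ^ (k + 1) + (k + 1) * t ^ 2 * n ^ k :=
          le_add_of_nonneg_right (by positivity)
      _ = (n ^ (k + 1) - (k + 1) * t * n ^ k) * (n - t) := by push_cast; ring
      _ ≤ (n - t) ^ (k + 1) * (n - t) := by
          have : 0 ≤ n - t := by linarith
          gcongr
      _ = _ := (pow_succ _ _).symm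

/-- For `s` large compared with `t`, a permutation moving `s` of `n` points has fewer orbits on
`(k + 1)`-tuples than there are tuples avoiding `t` given points, with a deficit of at least
`s * n ^ k / 4`; here `(n ^ (k + 1) + (n - s) ^ (k + 1)) / 2` bounds the number of orbits. -/
theorem two_mul_pow_add_pow_le {n s t k r : ℕ} (hk : k + 1 ≤ r) (hs : 4 * r * t ≤ s)
    (htn : t ≤ n) (hsn : s ≤ n) :
    2 * (n ^ (k + 1) + (n - s) ^ (k + 1)) + s * n ^ k ≤ 4 * (n - t) ^ (k + 1) := by
  have h1 := pow_sub_mul_le_sub_pow (n := n) (t := t) (by positivity) (by exact_mod_cast htn) k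
  have h2 : ((n : ℝ) - s) ^ (k + 1) ≤ (n - s) * (n : ℝ) ^ k := by
    have h0 : (0 : ℝ) ≤ (n : ℝ) - s := sub_nonneg.mpr (by exact_mod_cast hsn)
    rw [pow_succ']
    gcongr
    linarith [(Nat.cast_nonneg s : (0 : ℝ) ≤ s)]
  have h3 : (4 * ((k + 1) * t) : ℝ) * (n : ℝ) ^ k ≤ s * (n : ℝ) ^ k := by
    have : 4 * ((k + 1) * t) ≤ s := le_trans (by nlinarith) hs
    gcongr
    exact_mod_cast this
  have h4 : (n : ℝ) ^ (k + 1) = n * (n : ℝ) ^ k := pow_succ' _ _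
  have : (2 * ((n : ℝ) ^ (k + 1) + ((n : ℝ) - s) ^ (k + 1)) + s * (n : ℝ) ^ k) ≤
      4 * ((n : ℝ) - t) ^ (k + 1) := by
    rw [h4] at h1 ⊢
    linarith
  rw [← Nat.cast_sub hsn, ← Nat.cast_sub htn] at this
  exact_mod_cast this

/-! ### Structures with many moved points -/

section Negligible

variable (L : FirstOrder.Language.{u, v}) [Fintype (Σ k, L.Relations k)]

/-- The number of structures on `n` points with free choice of all relations on the tuples that
avoid `t` given points. -/
noncomputable def baseCount (t n : ℕ) : ℝ := 2 ^ ∑ R : Σ k, L.Relations k, (n - t) ^ R.1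

theorem baseCount_pos (t n : ℕ) : 0 < baseCount L t n := by
  unfold baseCount
  positivity

/-- A symbol of arity at least two makes the deficit of orbits at least linear in `n`, while the
other symbols do no harm. -/
theorem four_mul_sum_tupleOrbits_add_le (hr : ∃ k : ℕ, 2 ≤ k ∧ Nonempty (L.Relations k))
    {r t n : ℕ} (hL : ∀ R : Σ k, L.Relations k, R.1 ≤ r) (htn : t ≤ n) (g : Perm (Fin n))
    (hs : 4 * r * t ≤ g.support.card) :
    4 * ∑ R : Σ k, L.Relations k, tupleOrbits (Subgroup.zpowers g) R.1 + g.support.card * n ≤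
      4 * ∑ R : Σ k, L.Relations k, (n - t) ^ R.1 := by
  classical
  obtain ⟨k₀, hk₀, ⟨R₀⟩⟩ := hr
  have hsn : g.support.card ≤ n := (Finset.card_le_univ _).trans_eq (Fintype.card_fin n)
  have horb : ∀ R : Σ k, L.Relations k, 2 * tupleOrbits (Subgroup.zpowers g) R.1 ≤
      n ^ R.1 + (n - g.support.card) ^ R.1 := by
    intro R
    simpa using two_mul_tupleOrbits_zpowers_le g R.1
  have hterm : ∀ R : Σ k, L.Relations k, 4 * tupleOrbits (Subgroup.zpowers g) R.1 +
      (if R = ⟨k₀, R₀⟩ then g.support.card * n else 0) ≤ 4 * (n - t) ^ R.1 := by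
    rintro ⟨k, R⟩
    have h1 := horb ⟨k, R⟩
    have h2 := hL ⟨k, R⟩
    simp only at h1 h2 ⊢
    cases k with
    | zero =>
      rw [if_neg]
      · simp only [pow_zero] at h1 ⊢
        omega
      · intro h
        have := congrArg Sigma.fst h
        simp only at this
        omega
    | succ k =>
      have h3 := two_mul_pow_add_pow_le h2 hs htn hsn
      split_ifs with h
      · have hk : k + 1 = k₀ := congrArg Sigma.fst h
        have h4 : g.support.card * n ≤ g.support.card * n ^ k := by
          gcongr
          exact Nat.le_self_pow (by omega) n
        omega
      · have h4 : 0 ≤ g.support.card * n ^ k := Nat.zero_le _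
        omega
  have := Finset.sum_le_sum fun R (_ : R ∈ Finset.univ) => hterm R
  rw [Finset.sum_add_distrib, Finset.sum_ite_eq' Finset.univ, if_pos (Finset.mem_univ _),
    ← Finset.mul_sum, ← Finset.mul_sum] at this
  exact this

/-- A permutation is determined by its graph over its support. -/
theorem card_perm_support_le (n s : ℕ) :
    (Finset.univ.filter fun g : Perm (Fin n) => g.support.card = s).card ≤ n ^ (2 * s) := by
  classical
  have hex : ∀ g : {g : Perm (Fin n) // g.support.card = s},
      ∃ f : Fin s → Fin n × Fin n, Set.range f = (fun x => (x, g.1 x)) '' g.1.support := by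
    rintro ⟨g, hs⟩
    let e := g.support.equivFinOfCardEq hs
    refine ⟨fun i => ((e.symm i : Fin n), g (e.symm i)), ?_⟩
    ext p
    constructor
    · rintro ⟨i, rfl⟩
      exact ⟨_, (e.symm i).2, rfl⟩
    · rintro ⟨x, hx, rfl⟩
      exact ⟨e ⟨x, hx⟩, by simp⟩
  choose f hf using hex
  have hcard : Fintype.card (Fin s → Fin n × Fin n) = n ^ (2 * s) := by
    rw [Fintype.card_fun, Fintype.card_prod, Fintype.card_fin, Fintype.card_fin, pow_mul, sq]
  rw [← hcard, ← Fintype.card_subtype]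
  refine Fintype.card_le_of_injective f ?_
  rintro ⟨g, hg⟩ ⟨h, hh⟩ hgh
  apply Subtype.ext
  have himg : (fun x => (x, g x)) '' (g.support : Set (Fin n)) =
      (fun x => (x, h x)) '' (h.support : Set (Fin n)) := by
    rw [← hf ⟨g, hg⟩, ← hf ⟨h, hh⟩, hgh]
  refine Equiv.ext fun x => ?_
  change g x = h x
  by_cases hx : x ∈ g.support
  · have : (x, g x) ∈ (fun x => (x, h x)) '' (h.support : Set (Fin n)) := himg ▸ ⟨x, hx, rfl⟩
    obtain ⟨y, -, hy⟩ := this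
    obtain ⟨rfl, h2⟩ := Prod.mk.inj hy
    exact h2.symm
  · by_cases hx' : x ∈ h.support
    · have : (x, h x) ∈ (fun x => (x, g x)) '' (g.support : Set (Fin n)) := himg ▸ ⟨x, hx', rfl⟩
      obtain ⟨y, -, hy⟩ := this
      obtain ⟨rfl, h2⟩ := Prod.mk.inj hy
      exact h2
    · rw [Perm.notMem_support.mp hx, Perm.notMem_support.mp hx']

theorem sum_pow_support_le {n : ℕ} {θ : ℝ} (hθ : 0 ≤ θ) (hθ1 : (n : ℝ) ^ 2 * θ ^ n ≤ 1) :
    ∑ g : Perm (Fin n) with 0 < g.support.card, θ ^ (g.support.card * n) ≤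
      n * ((n : ℝ) ^ 2 * θ ^ n) := by
  classical
  have hmaps : Set.MapsTo (fun g : Perm (Fin n) => g.support.card)
      (Finset.univ.filter fun g : Perm (Fin n) => 0 < g.support.card)
      (Finset.Icc 1 n : Finset ℕ) := by
    intro g hg
    have h1 : 0 < g.support.card := by simpa using hg
    have h2 : g.support.card ≤ n := (Finset.card_le_univ _).trans_eq (Fintype.card_fin n)
    simp only [Finset.coe_Icc, Set.mem_Icc]
    omega
  rw [← Finset.sum_fiberwise_of_maps_to hmaps]
  calc ∑ s ∈ Finset.Icc 1 n, ∑ g ∈ (Finset.univ.filter fun g : Perm (Fin n) =>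
          0 < g.support.card) with g.support.card = s, θ ^ (g.support.card * n)
      ≤ ∑ s ∈ Finset.Icc 1 n, (n : ℝ) ^ 2 * θ ^ n := by
        refine Finset.sum_le_sum fun s hs => ?_
        have hs1 : s ≠ 0 := by
          have := (Finset.mem_Icc.mp hs).1
          omega
        calc ∑ g ∈ (Finset.univ.filter fun g : Perm (Fin n) =>
              0 < g.support.card) with g.support.card = s, θ ^ (g.support.card * n)
            = ∑ g ∈ (Finset.univ.filter fun g : Perm (Fin n) =>
              0 < g.support.card) with g.support.card = s, θ ^ (s * n) :=
              Finset.sum_congr rfl fun g hg => by rw [(Finset.mem_filter.mp hg).2]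
          _ = ((Finset.univ.filter fun g : Perm (Fin n) =>
              0 < g.support.card).filter fun g => g.support.card = s).card * θ ^ (s * n) := by
              rw [Finset.sum_const, nsmul_eq_mul]
          _ ≤ ((n ^ (2 * s) : ℕ) : ℝ) * θ ^ (s * n) := by
              gcongr
              exact (Finset.card_le_card (Finset.filter_subset_filter _
                (Finset.filter_subset _ _))).trans (card_perm_support_le n s)
          _ = ((n : ℝ) ^ 2 * θ ^ n) ^ s := by
              push_cast
              rw [mul_pow, ← pow_mul, ← pow_mul, mul_comm n s]
          _ ≤ (n : ℝ) ^ 2 * θ ^ n := pow_le_of_le_one (by positivity) hθ1 hs1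
    _ = n * ((n : ℝ) ^ 2 * θ ^ n) := by simp

/-- If more than `2 * S₀` points are moved, a single automorphism moves more than `S₀` points. -/
theorem card_many_movedPoints_le [L.IsRelational] (S₀ n : ℕ) :
    Nat.card {S : L.Structure (Fin n) // 2 * S₀ < (movedPoints (autGroup S)).ncard} ≤
      ∑ g : Perm (Fin n) with S₀ < g.support.card,
        2 ^ ∑ R : Σ k, L.Relations k, tupleOrbits (Subgroup.zpowers g) R.1 := by
  classical
  have := finite_structure L n
  have : Fintype (L.Structure (Fin n)) := Fintype.ofFinite _
  have hsub : (Finset.univ.filter fun S : L.Structure (Fin n) =>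
      2 * S₀ < (movedPoints (autGroup S)).ncard) ⊆
      (Finset.univ.filter fun g : Perm (Fin n) => S₀ < g.support.card).biUnion fun g =>
        Finset.univ.filter fun S : L.Structure (Fin n) => Subgroup.zpowers g ≤ autGroup S := by
    intro S hS
    have hS' : 2 * S₀ < (movedPoints (autGroup S)).ncard := (Finset.mem_filter.mp hS).2
    by_contra hcon
    refine absurd (ncard_movedPoints_le (autGroup S) S₀ fun g hg => ?_) (not_le.mpr hS')
    by_contra hgs
    refine hcon (Finset.mem_biUnion.mpr ⟨g, ?_, ?_⟩)
    · simpa using hgs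
    · simpa using hg
  rw [Nat.card_eq_fintype_card, Fintype.card_subtype]
  refine (Finset.card_le_card hsub).trans (Finset.card_biUnion_le.trans ?_)
  refine Finset.sum_le_sum fun g _ => ?_
  rw [← card_invariant_structures, Nat.card_eq_fintype_card, Fintype.card_subtype]

/-- Structures whose automorphisms move many points are negligible. -/
theorem card_many_movedPoints_mem_negligible [L.IsRelational]
    (hr : ∃ k : ℕ, 2 ≤ k ∧ Nonempty (L.Relations k)) (t : ℕ) :
    ∃ T : ℕ, (fun n : ℕ => (Nat.card {S : L.Structure (Fin n) //
      T < (movedPoints (autGroup S)).ncard} : ℝ)) ∈ negligible (baseCount L t) := by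
  classical
  obtain ⟨r, hL⟩ : ∃ r, ∀ R : Σ k, L.Relations k, R.1 ≤ r :=
    ⟨Finset.univ.sup fun R : Σ k, L.Relations k => R.1,
      fun R => Finset.le_sup (f := fun R : Σ k, L.Relations k => R.1) (Finset.mem_univ R)⟩
  refine ⟨2 * (4 * r * t), fun a => ?_⟩
  -- The deficit of `s * n / 4` orbits is turned into a factor `θ ^ (s * n)` with `θ ^ 4 = 1 / 2`.
  obtain ⟨θ, hθ0, hθ1, hθ4⟩ : ∃ θ : ℝ, 0 < θ ∧ θ < 1 ∧ θ ^ 4 = 1 / 2 := by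
    refine ⟨(1 / 2 : ℝ) ^ (1 / 4 : ℝ), by positivity,
      Real.rpow_lt_one (by norm_num) (by norm_num) (by norm_num), ?_⟩
    rw [← Real.rpow_natCast, ← Real.rpow_mul (by norm_num)]
    norm_num
  have hlim : ∀ b : ℕ, Tendsto (fun n : ℕ => (n : ℝ) ^ b * θ ^ n) atTop (𝓝 0) := fun b =>
    tendsto_pow_const_mul_const_pow_of_lt_one b hθ0.le hθ1
  refine squeeze_zero' (Eventually.of_forall fun n =>
    div_nonneg (by positivity) (baseCount_pos L t n).le) ?_ (hlim (a + 3))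
  filter_upwards [eventually_ge_atTop t, (hlim 2).eventually_le_const one_pos] with n hn hz
  have hbound : (Nat.card {S : L.Structure (Fin n) //
      2 * (4 * r * t) < (movedPoints (autGroup S)).ncard} : ℝ) ≤
      baseCount L t n * (n * ((n : ℝ) ^ 2 * θ ^ n)) := by
    calc (Nat.card {S : L.Structure (Fin n) //
          2 * (4 * r * t) < (movedPoints (autGroup S)).ncard} : ℝ)
        ≤ ∑ g : Perm (Fin n) with 4 * r * t < g.support.card,
          2 ^ ∑ R : Σ k, L.Relations k, tupleOrbits (Subgroup.zpowers g) R.1 := by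
          exact_mod_cast card_many_movedPoints_le L (4 * r * t) n
      _ ≤ ∑ g : Perm (Fin n) with 4 * r * t < g.support.card,
          baseCount L t n * θ ^ (g.support.card * n) := by
          refine Finset.sum_le_sum fun g hg => ?_
          have hg' := (Finset.mem_filter.mp hg).2
          have hexp := four_mul_sum_tupleOrbits_add_le L hr hL hn g hg'.le
          rw [baseCount]
          set A := ∑ R : Σ k, L.Relations k, tupleOrbits (Subgroup.zpowers g) R.1
          set B := ∑ R : Σ k, L.Relations k, (n - t) ^ R.1
          obtain ⟨d, hd⟩ : ∃ d, B = A + d := Nat.exists_eq_add_of_le (by omega)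
          have h1 : (2 : ℝ) ^ B * θ ^ (4 * d) = 2 ^ A := by
            rw [hd, pow_add, pow_mul, hθ4, mul_assoc, ← mul_pow]
            norm_num
          rw [← h1]
          gcongr 2 ^ B * ?_
          exact pow_le_pow_of_le_one hθ0.le hθ1.le (by omega)
      _ ≤ ∑ g : Perm (Fin n) with 0 < g.support.card,
          baseCount L t n * θ ^ (g.support.card * n) := by
          refine Finset.sum_le_sum_of_subset_of_nonneg ?_ fun g _ _ =>
            mul_nonneg (baseCount_pos L t n).le (by positivity)
          intro g hg
          have := (Finset.mem_filter.mp hg).2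
          exact Finset.mem_filter.mpr ⟨Finset.mem_univ _, by omega⟩
      _ ≤ _ := by
          rw [← Finset.mul_sum]
          exact mul_le_mul_of_nonneg_left (sum_pow_support_le hθ0.le hz)
            (baseCount_pos L t n).le
  rw [div_le_iff₀ (baseCount_pos L t n)]
  calc (n : ℝ) ^ a * _ ≤ (n : ℝ) ^ a * (baseCount L t n * (n * ((n : ℝ) ^ 2 * θ ^ n))) := by
        gcongr
    _ = (n : ℝ) ^ (a + 3) * θ ^ n * baseCount L t n := by ring

end Negligible

/-! ### Counting structures by their automorphism group -/

/-- The structures on `Fin n`, as a finite type. -/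
noncomputable instance structureFintype (L : FirstOrder.Language.{u, v}) [L.IsRelational]
    [Fintype (Σ k, L.Relations k)] (n : ℕ) : Fintype (L.Structure (Fin n)) :=
  @Fintype.ofFinite _ (finite_structure L n)

/-- The number of pairs of an injection `ι : Fin t ↪ Fin n` and a structure on `Fin n` whose
automorphism group is exactly the extension of `K` along `ι`. -/
noncomputable def exactCount (L : FirstOrder.Language.{u, v}) {t : ℕ}
    (K : Subgroup (Perm (Fin t))) (n : ℕ) : ℝ :=
  Nat.card {p : (Fin t ↪ Fin n) × L.Structure (Fin n) // autGroup p.2 = extendGroup p.1 K}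

theorem exactCount_congr (L : FirstOrder.Language.{u, v}) {s t : ℕ} (e : Fin s ≃ Fin t)
    (K : Subgroup (Perm (Fin s))) :
    exactCount L (extendGroup e.toEmbedding K) = exactCount L K := by
  funext n
  rw [exactCount, exactCount]
  congr 1
  symm
  refine Nat.card_congr (Equiv.subtypeEquiv
    ((e.embeddingCongr (Equiv.refl _)).prodCongr (Equiv.refl _)) ?_)
  rintro ⟨ι, S⟩
  have : ι = e.toEmbedding.trans (e.embeddingCongr (Equiv.refl _) ι) := by
    ext x
    simp [Equiv.embeddingCongr]
  simp only [Equiv.prodCongr_apply, Prod.map, Equiv.refl_apply]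
  rw [← extendGroup_trans, ← this]

section Counting

variable (L : FirstOrder.Language.{u, v}) [L.IsRelational] [Fintype (Σ k, L.Relations k)]

/-- The sum over all structures on `Fin n` of a weight depending on the automorphism group. -/
noncomputable def weightSum (W : (n : ℕ) → Subgroup (Perm (Fin n)) → ℚ) (n : ℕ) : ℝ :=
  ∑ S : L.Structure (Fin n), (W n (autGroup S) : ℝ)

/-- A weight on permutation groups that does not see fixed points. -/
def InvariantWeight (W : (n : ℕ) → Subgroup (Perm (Fin n)) → ℚ) : Prop :=
  ∀ (t n : ℕ) (ι : Fin t ↪ Fin n) (K : Subgroup (Perm (Fin t))),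
    movedPoints K = Set.univ → W n (extendGroup ι K) = W t K

open scoped Classical in
/-- Structures with exactly `t` moved points are sorted by the permutation group induced on these
points, each structure being met once for every enumeration of them. -/
theorem factorial_mul_sum_weight {W : (n : ℕ) → Subgroup (Perm (Fin n)) → ℚ}
    (hW : InvariantWeight W) (t n : ℕ) :
    (t.factorial : ℝ) * ∑ S : L.Structure (Fin n),
      (if (movedPoints (autGroup S)).ncard = t then (W n (autGroup S) : ℝ) else 0) =
    ∑ K : Subgroup (Perm (Fin t)) with movedPoints K = Set.univ,
      (W t K : ℝ) * exactCount L K n := by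
  have hexact : ∀ K : Subgroup (Perm (Fin t)), exactCount L K n =
      ∑ S : L.Structure (Fin n), ∑ ι : Fin t ↪ Fin n,
        if autGroup S = extendGroup ι K then 1 else 0 := by
    intro K
    rw [exactCount, Nat.card_eq_fintype_card, Fintype.card_subtype, Finset.card_filter,
      Nat.cast_sum, Fintype.sum_prod_type_right]
    simp
  have hpairs : ∀ S : L.Structure (Fin n),
      ((if (movedPoints (autGroup S)).ncard = t then t.factorial else 0 : ℕ) : ℝ) =
      ∑ K : Subgroup (Perm (Fin t)) with movedPoints K = Set.univ, ∑ ι : Fin t ↪ Fin n,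
        if autGroup S = extendGroup ι K then 1 else 0 := by
    intro S
    rw [← card_extendGroup_eq, Nat.card_eq_fintype_card, Fintype.card_subtype, Finset.card_filter,
      Nat.cast_sum, Fintype.sum_prod_type_right, Finset.sum_filter]
    refine Finset.sum_congr rfl fun K _ => ?_
    split_ifs with hK
    · refine Finset.sum_congr rfl fun ι _ => ?_
      simp [hK, eq_comm]
    · simp [hK]
  calc (t.factorial : ℝ) * ∑ S : L.Structure (Fin n),
        (if (movedPoints (autGroup S)).ncard = t then (W n (autGroup S) : ℝ) else 0)
      = ∑ S : L.Structure (Fin n),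
        ((if (movedPoints (autGroup S)).ncard = t then t.factorial else 0 : ℕ) : ℝ) *
          W n (autGroup S) := by
        rw [Finset.mul_sum]
        refine Finset.sum_congr rfl fun S _ => ?_
        split_ifs <;> simp
    _ = ∑ S : L.Structure (Fin n), ∑ K : Subgroup (Perm (Fin t)) with movedPoints K = Set.univ,
          (W t K : ℝ) * ∑ ι : Fin t ↪ Fin n, if autGroup S = extendGroup ι K then 1 else 0 := by
        refine Finset.sum_congr rfl fun S _ => ?_
        rw [hpairs, Finset.sum_mul]
        refine Finset.sum_congr rfl fun K hK => ?_
        rw [Finset.sum_mul, Finset.mul_sum]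
        refine Finset.sum_congr rfl fun ι _ => ?_
        split_ifs with h
        · rw [h, hW t n ι K (Finset.mem_filter.mp hK).2, one_mul, mul_one]
        · simp
    _ = _ := by
        rw [Finset.sum_comm]
        refine Finset.sum_congr rfl fun K _ => ?_
        rw [hexact, Finset.mul_sum]

open scoped Classical in
/-- Up to the negligible structures moving more than `T` points, the sum of a weight is a finite
rational combination of exact counts. -/
theorem weightSum_sub_mem_negligible {w : ℕ → ℝ} (hw : ∀ n, 0 < w n) {T : ℕ}
    (hT : (fun n : ℕ => (Nat.card {S : L.Structure (Fin n) //
      T < (movedPoints (autGroup S)).ncard} : ℝ)) ∈ negligible w)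
    {W : (n : ℕ) → Subgroup (Perm (Fin n)) → ℚ} (hW : InvariantWeight W) (b : ℕ)
    (hb : ∀ n H, |(W n H : ℝ)| ≤ (n : ℝ) ^ b) :
    weightSum L W - ∑ t ∈ Finset.range (T + 1),
      ∑ K : Subgroup (Perm (Fin t)) with movedPoints K = Set.univ,
        (W t K / t.factorial) • exactCount L K ∈ negligible w := by
  refine negligible_of_le hw hT b (Eventually.of_forall fun n => ?_)
  have hsmall : (∑ t ∈ Finset.range (T + 1),
      ∑ K : Subgroup (Perm (Fin t)) with movedPoints K = Set.univ,
        (W t K / t.factorial) • exactCount L K) n =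
      ∑ S : L.Structure (Fin n),
        if (movedPoints (autGroup S)).ncard ≤ T then (W n (autGroup S) : ℝ) else 0 := by
    rw [Finset.sum_apply]
    calc ∑ t ∈ Finset.range (T + 1),
          (∑ K : Subgroup (Perm (Fin t)) with movedPoints K = Set.univ,
            (W t K / t.factorial) • exactCount L K) n
        = ∑ t ∈ Finset.range (T + 1), ∑ S : L.Structure (Fin n),
          (if (movedPoints (autGroup S)).ncard = t then (W n (autGroup S) : ℝ) else 0) := by
          refine Finset.sum_congr rfl fun t _ => ?_
          have ht : (t.factorial : ℝ) ≠ 0 := by positivity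
          rw [← mul_right_inj' ht, factorial_mul_sum_weight L hW, Finset.sum_apply,
            Finset.mul_sum]
          refine Finset.sum_congr rfl fun K _ => ?_
          rw [Pi.smul_apply, Rat.smul_def]
          push_cast
          field_simp
      _ = _ := by
          rw [Finset.sum_comm]
          refine Finset.sum_congr rfl fun S _ => ?_
          rw [Finset.sum_ite_eq]
          simp only [Finset.mem_range, Nat.lt_succ_iff]
  have hdiff : (weightSum L W - ∑ t ∈ Finset.range (T + 1),
      ∑ K : Subgroup (Perm (Fin t)) with movedPoints K = Set.univ,
        (W t K / t.factorial) • exactCount L K) n =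
      ∑ S : L.Structure (Fin n) with T < (movedPoints (autGroup S)).ncard,
        (W n (autGroup S) : ℝ) := by
    rw [Pi.sub_apply, hsmall, weightSum, ← Finset.sum_sub_distrib, Finset.sum_filter]
    refine Finset.sum_congr rfl fun S _ => ?_
    by_cases h : T < (movedPoints (autGroup S)).ncard
    · rw [if_pos h, if_neg (not_le.mpr h), sub_zero]
    · rw [if_neg h, if_pos (not_lt.mp h), sub_self]
  rw [hdiff]
  refine (Finset.abs_sum_le_sum_abs _ _).trans ((Finset.sum_le_sum fun S _ => hb n _).trans ?_)
  rw [Finset.sum_const, nsmul_eq_mul, mul_comm, Nat.card_eq_fintype_card, Fintype.card_subtype]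

/-- The weight counting the embeddings of a fixed permutation group. -/
noncomputable def embWeight {t : ℕ} (K : Subgroup (Perm (Fin t))) (n : ℕ)
    (H : Subgroup (Perm (Fin n))) : ℚ := embCount K H

theorem invariantWeight_embWeight {t : ℕ} (K : Subgroup (Perm (Fin t)))
    (hK : movedPoints K = Set.univ) : InvariantWeight (embWeight K) := by
  intro s n ι H _
  rw [embWeight, embWeight, embCount_extendGroup K hK]

theorem embWeight_le {t : ℕ} (K : Subgroup (Perm (Fin t))) (n : ℕ) (H : Subgroup (Perm (Fin n))) :
    |(embWeight K n H : ℝ)| ≤ (n : ℝ) ^ t := by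
  rw [embWeight, Rat.cast_natCast, abs_of_nonneg (Nat.cast_nonneg _)]
  have h1 : embCount K H ≤ Nat.card (Fin t ↪ Fin n) := by
    rw [embCount]
    exact Nat.card_le_card_of_injective _ Subtype.val_injective
  rw [Nat.card_eq_fintype_card, Fintype.card_embedding_eq, Fintype.card_fin, Fintype.card_fin] at h1
  exact_mod_cast h1.trans (Nat.descFactorial_le_pow _ _)

theorem descFactorial_mul_two_pow_mem_expSpan (t : ℕ) (ν : ℕ → ℕ) (P : Polynomial ℝ)
    (hP : ∀ᶠ n : ℕ in atTop, (ν n : ℝ) = P.eval (n : ℝ)) :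
    (fun n : ℕ => (n.descFactorial t : ℝ) * 2 ^ ν n) ∈ expSpan := by
  have : (fun n : ℕ => (n.descFactorial t : ℝ) * 2 ^ ν n) =
      ∑ i ∈ Finset.range ((descPochhammer ℚ t).natDegree + 1),
        (descPochhammer ℚ t).coeff i • fun n : ℕ => (n : ℝ) ^ i * 2 ^ ν n := by
    funext n
    have h : (n.descFactorial t : ℚ) = ∑ i ∈ Finset.range ((descPochhammer ℚ t).natDegree + 1),
        (descPochhammer ℚ t).coeff i * (n : ℚ) ^ i := by
      rw [← descPochhammer_eval_eq_descFactorial, Polynomial.eval_eq_sum_range]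
    have h' : (n.descFactorial t : ℝ) = ((n.descFactorial t : ℚ) : ℝ) := by push_cast; rfl
    rw [h', h, Finset.sum_apply, Rat.cast_sum, Finset.sum_mul]
    refine Finset.sum_congr rfl fun i _ => ?_
    rw [Pi.smul_apply, Rat.smul_def]
    push_cast
    ring
  rw [this]
  exact sum_mem fun i _ => Submodule.smul_mem _ _ (Submodule.subset_span ⟨i, ν, P, hP, rfl⟩)

open scoped Classical in
/-- Exchanging the order of counting: for each injection, count the structures invariant under the
extended group. -/
theorem weightSum_embWeight_eq {t : ℕ} (K : Subgroup (Perm (Fin t))) (n : ℕ) :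
    weightSum L (embWeight K) n = ∑ ι : Fin t ↪ Fin n,
      (2 : ℝ) ^ ∑ R : Σ k, L.Relations k, tupleOrbits (extendGroup ι K) R.1 := by
  have h : ∀ ι : Fin t ↪ Fin n,
      (2 : ℝ) ^ ∑ R : Σ k, L.Relations k, tupleOrbits (extendGroup ι K) R.1 =
      ∑ S : L.Structure (Fin n), if extendGroup ι K ≤ autGroup S then 1 else 0 := by
    intro ι
    have := card_invariant_structures L (extendGroup ι K)
    rw [Nat.card_eq_fintype_card, Fintype.card_subtype, Finset.card_filter] at this
    exact_mod_cast this.symm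
  simp only [h]
  rw [Finset.sum_comm, weightSum]
  refine Finset.sum_congr rfl fun S _ => ?_
  rw [embWeight, embCount, Nat.card_eq_fintype_card, Fintype.card_subtype, Finset.card_filter]
  simp

theorem weightSum_embWeight_mem {w : ℕ → ℝ} {t : ℕ} (K : Subgroup (Perm (Fin t))) :
    weightSum L (embWeight K) ∈ expSpan ⊔ negligible w := by
  choose P hP using fun R : Σ k, L.Relations k => exists_polynomial_tupleOrbits K R.1
  have hsum : ∀ n, t ≤ n → ∀ ι : Fin t ↪ Fin n,
      ((∑ R : Σ k, L.Relations k, tupleOrbits (extendGroup ι K) R.1 : ℕ) : ℝ) =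
        (∑ R, P R).eval (n : ℝ) := by
    intro n hn ι
    rw [Nat.cast_sum, Polynomial.eval_finsetSum]
    exact Finset.sum_congr rfl fun R _ => hP R n hn ι
  let ν : ℕ → ℕ := fun n => if h : t ≤ n then
    ∑ R : Σ k, L.Relations k, tupleOrbits (extendGroup (Fin.castLEEmb h) K) R.1 else 0
  refine mem_expSpan_sup_negligible_of_eventuallyEq (Submodule.mem_sup_left
    (descFactorial_mul_two_pow_mem_expSpan t ν (∑ R, P R) ?_)) ?_
  · filter_upwards [eventually_ge_atTop t] with n hn
    simp only [ν, dif_pos hn]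
    exact hsum n hn _
  · filter_upwards [eventually_ge_atTop t] with n hn
    have hν : ∀ ι : Fin t ↪ Fin n,
        ∑ R : Σ k, L.Relations k, tupleOrbits (extendGroup ι K) R.1 = ν n := by
      intro ι
      have h1 := (hsum n hn ι).trans (hsum n hn (Fin.castLEEmb hn)).symm
      simp only [ν, dif_pos hn]
      exact_mod_cast h1
    rw [weightSum_embWeight_eq, Finset.sum_congr rfl fun ι _ => by rw [hν ι], Finset.sum_const,
      Finset.card_univ, Fintype.card_embedding_eq, Fintype.card_fin, Fintype.card_fin,
      nsmul_eq_mul]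

open scoped Classical in
/-- The counts of structures with prescribed automorphism group solve a linear system, triangular
with respect to the order of the group, whose right-hand sides count structures with at least the
given automorphisms. -/
theorem exactCount_mem {w : ℕ → ℝ} (hw : ∀ n, 0 < w n) {T : ℕ}
    (hT : (fun n : ℕ => (Nat.card {S : L.Structure (Fin n) //
      T < (movedPoints (autGroup S)).ncard} : ℝ)) ∈ negligible w)
    {t : ℕ} (ht : t ≤ T) (K : Subgroup (Perm (Fin t))) (hK : movedPoints K = Set.univ) :
    exactCount L K ∈ expSpan ⊔ negligible w := by
  induction hd : T.factorial - Nat.card K using Nat.strong_induction_on generalizing t K with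
  | _ d ih =>
    have hcard : ∀ {s : ℕ}, s ≤ T → ∀ H : Subgroup (Perm (Fin s)), Nat.card H ≤ T.factorial := by
      intro s hs H
      refine (Subgroup.card_le_card_group H).trans ?_
      rw [Nat.card_eq_fintype_card, Fintype.card_perm, Fintype.card_fin]
      exact Nat.factorial_le hs
    let J : Finset (Σ s : ℕ, Subgroup (Perm (Fin s))) :=
      (Finset.range (T + 1)).sigma fun s => Finset.univ.filter fun H => movedPoints H = Set.univ
    let c : (Σ s : ℕ, Subgroup (Perm (Fin s))) → ℚ := fun i => embWeight K i.1 i.2 / i.1.factorial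
    have hmemJ : ∀ i, i ∈ J ↔ i.1 ≤ T ∧ movedPoints i.2 = Set.univ := by
      intro i
      simp [J]
    have hc : ∀ i, 0 ≤ c i := fun i => by simp only [c, embWeight]; positivity
    have htotal : ∑ i ∈ J, c i • exactCount L i.2 ∈ expSpan ⊔ negligible w := by
      have h1 := weightSum_sub_mem_negligible L hw hT (invariantWeight_embWeight K hK) t
        (embWeight_le K)
      have h2 := sub_mem (weightSum_embWeight_mem L K) (Submodule.mem_sup_right (S := expSpan) h1)
      rw [sub_sub_cancel, Finset.sum_sigma'] at h2
      exact h2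
    rw [← Finset.sum_filter_add_sum_filter_not J (fun i => exactCount L i.2 = exactCount L K)]
      at htotal
    -- The remaining terms with nonzero coefficient belong to larger groups.
    have hlarger : ∑ i ∈ J with ¬ exactCount L i.2 = exactCount L K, c i • exactCount L i.2 ∈
        expSpan ⊔ negligible w := by
      refine sum_mem fun i hi => ?_
      obtain ⟨hiJ, hne⟩ := Finset.mem_filter.mp hi
      obtain ⟨hiT, hiK⟩ := (hmemJ i).mp hiJ
      by_cases h0 : embCount K i.2 = 0
      · have : c i = 0 := by simp [c, embWeight, h0]
        rw [this, zero_smul]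
        exact zero_mem _
      · rcases card_lt_or_of_embCount_ne_zero hiK h0 with h | ⟨e, he⟩
        · refine Submodule.smul_mem _ _ (ih _ ?_ hiT i.2 hiK rfl)
          have := hcard hiT i.2
          omega
        · exact absurd (he ▸ exactCount_congr L e K) hne
    have heq : ∑ i ∈ J with exactCount L i.2 = exactCount L K, c i • exactCount L i.2 =
        (∑ i ∈ J with exactCount L i.2 = exactCount L K, c i) • exactCount L K := by
      rw [Finset.sum_smul]
      exact Finset.sum_congr rfl fun i hi => by rw [(Finset.mem_filter.mp hi).2]
    have hpos : 0 < ∑ i ∈ J with exactCount L i.2 = exactCount L K, c i := by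
      refine Finset.sum_pos' (fun i _ => hc i) ⟨⟨t, K⟩, ?_, ?_⟩
      · exact Finset.mem_filter.mpr ⟨(hmemJ _).mpr ⟨ht, hK⟩, rfl⟩
      · have := embCount_self_pos K
        simp only [c, embWeight]
        positivity
    rw [heq] at htotal
    have h3 := Submodule.smul_mem _ (∑ i ∈ J with exactCount L i.2 = exactCount L K, c i)⁻¹
      (sub_mem htotal hlarger)
    rwa [add_sub_cancel_right, smul_smul, inv_mul_cancel₀ hpos.ne', one_smul] at h3

theorem weightSum_mem (hr : ∃ k : ℕ, 2 ≤ k ∧ Nonempty (L.Relations k)) (t₀ : ℕ)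
    {W : (n : ℕ) → Subgroup (Perm (Fin n)) → ℚ} (hW : InvariantWeight W) (b : ℕ)
    (hb : ∀ n H, |(W n H : ℝ)| ≤ (n : ℝ) ^ b) :
    weightSum L W ∈ expSpan ⊔ negligible (baseCount L t₀) := by
  classical
  obtain ⟨T, hT⟩ := card_many_movedPoints_mem_negligible L hr t₀
  have hw := baseCount_pos L t₀
  have h1 := Submodule.mem_sup_right (S := expSpan)
    (weightSum_sub_mem_negligible L hw hT hW b hb)
  have h2 : ∑ t ∈ Finset.range (T + 1),
      ∑ K : Subgroup (Perm (Fin t)) with movedPoints K = Set.univ,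
        (W t K / t.factorial) • exactCount L K ∈ expSpan ⊔ negligible (baseCount L t₀) :=
    sum_mem fun t ht => sum_mem fun K hK => Submodule.smul_mem _ _
      (exactCount_mem L hw hT (Nat.lt_succ_iff.mp (Finset.mem_range.mp ht)) K
        (Finset.mem_filter.mp hK).2)
  have h3 := add_mem h1 h2
  rwa [sub_add_cancel] at h3

/-- Any isomorphism-invariant property of the automorphism group holds for an
exponential-polynomial number of structures, up to a negligible error. -/
theorem ncard_mem (hr : ∃ k : ℕ, 2 ≤ k ∧ Nonempty (L.Relations k)) (t₀ : ℕ)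
    (p : (n : ℕ) → Subgroup (Perm (Fin n)) → Prop)
    (hp : ∀ (m n : ℕ) (H : Subgroup (Perm (Fin m))) (H' : Subgroup (Perm (Fin n))),
      Nonempty (H ≃* H') → (p m H ↔ p n H')) :
    (fun n : ℕ => (({S : L.Structure (Fin n) | p n (autGroup S)} : Set _).ncard : ℝ)) ∈
      expSpan ⊔ negligible (baseCount L t₀) := by
  classical
  have h := weightSum_mem L hr t₀ (W := fun n H => if p n H then 1 else 0)
    (fun t n ι K _ => if_congr (hp _ _ _ _ ⟨(extendGroupEquiv ι K).symm⟩) rfl rfl) 0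
    (fun n H => by rw [pow_zero]; split_ifs <;> simp)
  convert h using 1
  funext n
  rw [weightSum, Set.ncard_eq_toFinset_card', Set.toFinset_ofPred, ← Finset.sum_boole]
  refine Finset.sum_congr rfl fun S _ => ?_
  split_ifs <;> simp

/-- The regular representation of `G` on `t` points yields structures in which `G` acts, with all
relations between the remaining points free. -/
theorem baseCount_le_ncard (G : Type w) [Group G] [Finite G] {n : ℕ} (hn : Nat.card G ≤ n) :
    baseCount L (Nat.card G) n ≤ ((structuresWithSubgroup L G n).ncard : ℝ) := by
  classical
  let f : G →* Perm (Fin (Nat.card G)) :=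
    ((Finite.equivFin G).permCongrHom : Perm G →* _).comp (MulAction.toPermHom G G)
  have hf : Function.Injective f :=
    (Finite.equivFin G).permCongrHom.injective.comp MulAction.toPerm_injective
  let H := extendGroup (Fin.castLEEmb hn) f.range
  have hG : Nonempty (G ≃* H) := ⟨(f.ofInjective hf).trans (extendGroupEquiv _ _)⟩
  obtain ⟨e⟩ := hG
  have hsub : {S : L.Structure (Fin n) | H ≤ autGroup S} ⊆ structuresWithSubgroup L G n :=
    fun S hS => ⟨H.subgroupOf (autGroup S), ⟨e.trans (Subgroup.subgroupOfEquivOfLe hS).symm⟩⟩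
  have h1 := Set.ncard_le_ncard hsub (Set.toFinite _)
  rw [← Nat.card_coe_set_eq] at h1
  have h2 := (card_invariant_structures L H).symm.le.trans h1
  rw [baseCount]
  have h3 : ∑ R : Σ k, L.Relations k, (n - Nat.card G) ^ R.1 ≤
      ∑ R : Σ k, L.Relations k, tupleOrbits H R.1 := by
    refine Finset.sum_le_sum fun R _ => ?_
    have := pow_le_tupleOrbits_extendGroup (Fin.castLEEmb hn) f.range R.1
    rwa [Fintype.card_fin, Fintype.card_fin] at this
  exact_mod_cast (Nat.pow_le_pow_right (by norm_num) h3).trans h2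

end Counting

end FiniteStructures

theorem mainTheorem9 (L : FirstOrder.Language.{u, v}) [L.IsRelational] [Finite (Σ k, L.Relations k)]
    (hr : ∃ k : ℕ, 2 ≤ k ∧ Nonempty (L.Relations k))
    (G : Type w) [Group G] [Finite G] :
    (∀ᶠ n : ℕ in atTop, 0 < (FiniteStructures.structuresWithSubgroup L G n).ncard) ∧
    ∃ a : ℚ, 0 ≤ a ∧ a ≤ 1 ∧
      Tendsto
        (fun n : ℕ => ((FiniteStructures.structuresWithAutGroup L G n).ncard : ℝ) /
          ((FiniteStructures.structuresWithSubgroup L G n).ncard : ℝ))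
        atTop (𝓝 (a : ℝ)) := by
  open FiniteStructures in
  have := Fintype.ofFinite (Σ k, L.Relations k)
  have hbase : ∀ᶠ n : ℕ in atTop,
      baseCount L (Nat.card G) n ≤ ((structuresWithSubgroup L G n).ncard : ℝ) := by
    filter_upwards [eventually_ge_atTop (Nat.card G)] with n hn
    exact baseCount_le_ncard L G hn
  have hpos := baseCount_pos L (Nat.card G)
  refine ⟨?_, exists_rat_limit hpos ?_ ?_ hbase (fun n => Nat.cast_nonneg _) fun n => ?_⟩
  · filter_upwards [hbase] with n hn
    exact_mod_cast (hpos n).trans_le hn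
  · refine ncard_mem L hr _ (fun n H => Nonempty (G ≃* H)) ?_
    rintro m n H H' ⟨e⟩
    exact ⟨fun ⟨f⟩ => ⟨f.trans e⟩, fun ⟨f⟩ => ⟨f.trans e.symm⟩⟩
  · refine ncard_mem L hr _ (fun n H => IsoToSubgroup G H) ?_
    rintro m n H H' ⟨e⟩
    exact ⟨fun ⟨K, ⟨f⟩⟩ => ⟨K.map e.toMonoidHom,
        ⟨f.trans (K.equivMapOfInjective _ e.injective)⟩⟩,
      fun ⟨K, ⟨f⟩⟩ => ⟨K.map e.symm.toMonoidHom,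
        ⟨f.trans (K.equivMapOfInjective _ e.symm.injective)⟩⟩⟩
  · have hsub : structuresWithAutGroup L G n ⊆ structuresWithSubgroup L G n :=
      fun S ⟨e⟩ => ⟨⊤, ⟨e.trans Subgroup.topEquiv.symm⟩⟩
    exact_mod_cast Set.ncard_le_ncard hsub (Set.toFinite _)
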